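/- Let $N\ge 0$ be an integer, $I=\{1,\dots,N\}$, let $i\mapsto[i]\in\mathbb Z/2$ be an arbitrary parity function on $I$, and let $q\in\mathbb C$ with $q\neq0$, $q^4\neq1$. Grade $\mathrm{End}(\mathbb C^N)$ by giving the matrix unit $e_{ij}$ the degree $[i]+[j]$, and let $\mathrm{End}(\mathbb C^N)\otimes\mathrm{End}(\mathbb C^N)$ be the graded tensor product, with $(a_1\otimes b_1)(a_2\otimes b_2)=(-1)^{\deg a_2\deg b_1}a_1a_2\otimes b_1b_2$ on homogeneous elements. In it put $$R=\sum_{i,j}q^{(-1)^{[i]}\delta_{ij}}\,e_{ii}\otimes e_{jj}+(q-q^{-1})\sum_{i>j}(-1)^{[j]}e_{ij}\otimes e_{ji},\qquad P=\sum_{i,j}(-1)^{[j]}e_{ij}\otimes e_{ji},\qquad S=PR .$$ A matrix $A\in\mathrm{End}(\mathbb C^N)$ (not assumed even) solves the graded reflection equation if $SA_2SA_2=A_2SA_2S$, where $A_2=1\otimes A$. An admissible pair $(Y,\sigma)$ is a subset $Y\subseteq I$ with a strictly decreasing, parity preserving map $\sigma\colon Y\to I$ without fixed points. Put $Y_+=\{i\in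 Y: i>\sigma(i)\}$, $Y_-=\{i\in Y: i<\sigma(i)\}$, $b_-=\max(Y_-\cup\sigma(Y_+))$, $b_+=\min(Y_+\cup\sigma(Y_-))$, with $b_-=0$, $b_+=N+1$ if $Y=\varnothing$. Intervals are intervals of integers. **Theorem.** Every solution $A$ of the graded reflection equation is even. Moreover, $A$ is a solution if and only if $$A=\sum_{i\in I}x_i\,e_{ii}+\sum_{j\in Y}y_j\,e_{\sigma(j)j}$$ for an admissible pair $(Y,\sigma)$ and complex numbers $x_i$, $y_j$ satisfying one of the following. * Type 1: $\sigma(Y)=Y$, $Y=[1,b_-]\cup[b_+,b_++b_--1]$, $\sigma(i)=b_++b_--i$ for $i\in Y$, $b_-<b_+$, $b_-+b_+\le N+1$, and there are $\lambda,\mu\in\mathbb C$ with $\lambda\mu\ne0$ such that $x_i=\lambda+\mu$ for $i\in[1,b_-]$, $x_i=\lambda$ for $i\in(b_-,b_+)$, $x_i=0$ for $i\in[b_+,N]$, and $y_iy_{\sigma(i)}=-\lambda\mu$ for all $i\in Y$. * Type 2: $Y\cap\sigma(Y)=\varnothing$, $y_i\ne0$ for all $i\in Y$, and there are $\lambda\in\mathbb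 C$ and an integer $b$ with $b_-\le b<b_+$ such that $x_i=\lambda$ for $i\in[1,b]$ and $x_i=0$ for $i\in(b,N]$. -/

import Mathlib

open scoped TensorProduct

noncomputable section

namespace GradedRE

/-- The `ℤ/2`-grading of `End(ℂ^N)` (as `N × N` matrices) attached to a parity function `p` on the
basis: the component of degree `d` is spanned by the matrix units `e_{ij}` with
`[i] + [j] = d`, i.e. it consists of the matrices whose nonzero entries sit at such places.
Degree `0` matrices are called even. -/
def grading {N : ℕ} (p : Fin N → ZMod 2) (d : ZMod 2) :
    Submodule ℂ (Matrix (Fin N) (Fin N) ℂ) where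
  carrier := {M | ∀ i j, M i j ≠ 0 → p i + p j = d}
  zero_mem' := by intro i j h; simp at h
  add_mem' := by
    intro A B hA hB i j h
    by_cases hAij : A i j = 0
    · exact hB i j (by intro h0; apply h; simp [hAij, h0])
    · exact hA i j hAij
  smul_mem' := by
    intro c A hA i j h
    exact hA i j (by intro h0; apply h; simp [h0])

theorem mem_grading {N : ℕ} (p : Fin N → ZMod 2) (d : ZMod 2) (M : Matrix (Fin N) (Fin N) ℂ) :
    M ∈ grading p d ↔ ∀ i j, M i j ≠ 0 → p i + p j = d := Iff.rfl

/-- The part of degree `d` of a matrix. -/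
def part {N : ℕ} (p : Fin N → ZMod 2) (d : ZMod 2) (M : Matrix (Fin N) (Fin N) ℂ) :
    grading p d :=
  ⟨Matrix.of fun i j => if p i + p j = d then M i j else 0, by
    intro i j h
    rw [Matrix.of_apply] at h
    by_contra h'
    exact h (if_neg h')⟩

instance gradedMonoid {N : ℕ} (p : Fin N → ZMod 2) : SetLike.GradedMonoid (grading p) where
  one_mem := by
    intro i j h
    have hij : i = j := by
      by_contra h'
      exact h (Matrix.one_apply_ne h')
    rw [hij]
    exact CharTwo.add_self_eq_zero _
  mul_mem := by
    intro d e A B hA hB i j h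
    rw [Matrix.mul_apply] at h
    obtain ⟨k, -, hk⟩ := Finset.exists_ne_zero_of_sum_ne_zero h
    have h1 := hA i k (left_ne_zero_of_mul hk)
    have h2 := hB k j (right_ne_zero_of_mul hk)
    rw [← h1, ← h2]
    have h3 : p k + p k = 0 := CharTwo.add_self_eq_zero _
    calc p i + p j = p i + (p k + p k) + p j := by rw [h3, add_zero]
      _ = p i + p k + (p k + p j) := by ring

instance decomposition {N : ℕ} (p : Fin N → ZMod 2) : DirectSum.Decomposition (grading p) where
  decompose' M := ∑ d, DirectSum.of (fun d => grading p d) d (part p d M)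
  left_inv M := by
    rw [map_sum]
    simp only [DirectSum.coeAddMonoidHom_of]
    ext i j
    rw [Matrix.sum_apply]
    simp [part]
  right_inv x := by
    induction x using DirectSum.induction_on with
    | zero =>
      refine Finset.sum_eq_zero fun d _ => ?_
      have : part p d (DirectSum.coeAddMonoidHom (grading p) 0) = 0 := by
        ext i j
        simp [part]
      rw [this, map_zero]
    | of e M =>
      rw [DirectSum.coeAddMonoidHom_of]
      dsimp only
      rw [Finset.sum_eq_single e]
      · congr 1
        ext i j
        by_cases h : (M : Matrix (Fin N) (Fin N) ℂ) i j = 0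
        · simp [part, h]
        · simp [part, M.2 i j h]
      · intro d _ hd
        have : part p d (M : Matrix (Fin N) (Fin N) ℂ) = 0 := by
          ext i j
          by_cases h : (M : Matrix (Fin N) (Fin N) ℂ) i j = 0
          · simp [part, h]
          · have h2 := M.2 i j h
            simp [part, h2, Ne.symm hd]
        rw [this, map_zero]
      · intro h
        exact absurd (Finset.mem_univ e) h
    | add x y hx hy =>
      rw [map_add]
      conv_rhs => rw [← hx, ← hy]
      rw [← Finset.sum_add_distrib]
      refine Finset.sum_congr rfl fun d _ => ?_
      rw [← (DirectSum.of (fun d => grading p d) d).map_add]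
      refine congrArg (DirectSum.of (fun d => grading p d) d) ?_
      ext i j
      by_cases h : p i + p j = d <;> simp [part, h]

instance gradedAlgebra {N : ℕ} (p : Fin N → ZMod 2) : GradedAlgebra (grading p) where

/-- The graded tensor square `End(V) ⊗ End(V)`, with the multiplication
`(a₁ ⊗ b₁)(a₂ ⊗ b₂) = (-1)^{deg a₂ deg b₁} a₁a₂ ⊗ b₁b₂` on homogeneous elements. -/
abbrev EndSq {N : ℕ} (p : Fin N → ZMod 2) : Type :=
  grading p ᵍ⊗[ℂ] grading p

/-- The simple tensor `a ⊗ b` in the graded tensor square. -/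
abbrev tens {N : ℕ} (p : Fin N → ZMod 2) (a b : Matrix (Fin N) (Fin N) ℂ) : EndSq p :=
  GradedTensorProduct.tmul ℂ a b

/-- The matrix unit `e_{ij}`. -/
abbrev e {N : ℕ} (i j : Fin N) : Matrix (Fin N) (Fin N) ℂ := Matrix.single i j 1

/-- The sign `(-1)^d` of a parity. -/
def sgn (d : ZMod 2) : ℤ := if d = 0 then 1 else -1

/-- The graded `R`-matrix of `GL`-type,
`R = ∑_{i,j} q^{(-1)^{[i]} δ_{ij}} e_{ii} ⊗ e_{jj} + (q - q⁻¹) ∑_{i>j} (-1)^{[j]} e_{ij} ⊗ e_{ji}`. -/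
def R {N : ℕ} (p : Fin N → ZMod 2) (q : ℂ) : EndSq p :=
  (∑ i, ∑ j, (q ^ (if i = j then sgn (p i) else 0)) • tens p (e i i) (e j j)) +
    (q - q⁻¹) • ∑ i, ∑ j ∈ Finset.univ.filter (fun j => j < i),
      (sgn (p j) : ℂ) • tens p (e i j) (e j i)

/-- The graded permutation `P = ∑_{i,j} (-1)^{[j]} e_{ij} ⊗ e_{ji}`. -/
def P {N : ℕ} (p : Fin N → ZMod 2) : EndSq p :=
  ∑ i, ∑ j, (sgn (p j) : ℂ) • tens p (e i j) (e j i)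

/-- The braid operator `S = P R`. -/
def S {N : ℕ} (p : Fin N → ZMod 2) (q : ℂ) : EndSq p := P p * R p q

/-- The graded reflection equation `S A₂ S A₂ = A₂ S A₂ S`, where `A₂ = 1 ⊗ A`. No parity
assumption is made on `A`. -/
def ReflectionEquation {N : ℕ} (p : Fin N → ZMod 2) (q : ℂ)
    (A : Matrix (Fin N) (Fin N) ℂ) : Prop :=
  S p q * tens p 1 A * S p q * tens p 1 A = tens p 1 A * S p q * tens p 1 A * S p q

/-- The position in `{1, …, N}` of an index; `Fin N` counts from zero. -/
def pos {N : ℕ} (i : Fin N) : ℕ := (i : ℕ) + 1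

/-- An admissible pair: a subset `Y` of the index set and a parity preserving, strictly decreasing
map `σ` from `Y` to the index set without fixed points. -/
structure AdmissiblePair {N : ℕ} (p : Fin N → ZMod 2) where
  Y : Finset (Fin N)
  σ : {i // i ∈ Y} → Fin N
  parity : ∀ i : {i // i ∈ Y}, p (σ i) = p i.1
  decreasing : StrictAnti σ
  no_fixed : ∀ i : {i // i ∈ Y}, σ i ≠ i.1

namespace AdmissiblePair

variable {N : ℕ} {p : Fin N → ZMod 2} (D : AdmissiblePair p)

/-- The image `σ(Y)`. -/
def image : Finset (Fin N) := D.Y.attach.image D.σ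

/-- `Y₋ ∪ σ(Y₊)`, where `Y₋ = {i ∈ Y | i < σ(i)}` and `Y₊ = {i ∈ Y | i > σ(i)}`. -/
def lower : Finset (Fin N) :=
  ((D.Y.attach.filter fun i => i.1 < D.σ i).image fun i => i.1) ∪
    ((D.Y.attach.filter fun i => D.σ i < i.1).image D.σ)

/-- `Y₊ ∪ σ(Y₋)`. -/
def upper : Finset (Fin N) :=
  ((D.Y.attach.filter fun i => D.σ i < i.1).image fun i => i.1) ∪
    ((D.Y.attach.filter fun i => i.1 < D.σ i).image D.σ)

/-- `b₋ = max (Y₋ ∪ σ(Y₊))`, and `b₋ = 0` if `Y` is empty. -/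
def bMinus : ℕ := if h : D.lower.Nonempty then D.lower.sup' h pos else 0

/-- `b₊ = min (Y₊ ∪ σ(Y₋))`, and `b₊ = N + 1` if `Y` is empty. -/
def bPlus : ℕ := if h : D.upper.Nonempty then D.upper.inf' h pos else N + 1

/-- The matrix `∑_i x_i e_{ii} + ∑_{j ∈ Y} y_j e_{σ(j) j}`. Only the values of `y` on `Y`
matter. -/
def matrix (x y : Fin N → ℂ) : Matrix (Fin N) (Fin N) ℂ :=
  ∑ i, x i • e i i + ∑ j ∈ D.Y.attach, y j.1 • e (D.σ j) j.1

end AdmissiblePair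

/-- Matrices of the first family: `σ(Y) = Y`, `Y = [1, b₋] ∪ [b₊, b₊ + b₋ - 1]`,
`σ(i) = b₊ + b₋ - i`, the diagonal entries are `λ + μ` on `[1, b₋]`, `λ` on `(b₋, b₊)` and `0` on
`[b₊, N]`, and `y_i y_{σ(i)} = -λμ ≠ 0` (here `l = λ`, `m = μ`). -/
def IsType1 {N : ℕ} (p : Fin N → ZMod 2) (A : Matrix (Fin N) (Fin N) ℂ) : Prop :=
  ∃ (D : AdmissiblePair p) (x y : Fin N → ℂ) (l m : ℂ),
    A = D.matrix x y ∧
    D.bMinus < D.bPlus ∧ D.bMinus + D.bPlus ≤ N + 1 ∧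
    D.image = D.Y ∧
    (∀ i, i ∈ D.Y ↔
      pos i ≤ D.bMinus ∨ (D.bPlus ≤ pos i ∧ pos i < D.bPlus + D.bMinus)) ∧
    (∀ i : {i // i ∈ D.Y}, pos (D.σ i) + pos i.1 = D.bPlus + D.bMinus) ∧
    (∀ i, pos i ≤ D.bMinus → x i = l + m) ∧
    (∀ i, D.bMinus < pos i → pos i < D.bPlus → x i = l) ∧
    (∀ i, D.bPlus ≤ pos i → x i = 0) ∧
    (∀ i : {i // i ∈ D.Y}, y i.1 * y (D.σ i) = -(l * m)) ∧
    l * m ≠ 0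

/-- Matrices of the second family: `Y ∩ σ(Y) = ∅`, the diagonal entries are `λ` on `[1, b]` and `0`
on `(b, N]` for some `b` with `b₋ ≤ b < b₊`, and `y_i ≠ 0` for all `i ∈ Y` (here `l = λ`). -/
def IsType2 {N : ℕ} (p : Fin N → ZMod 2) (A : Matrix (Fin N) (Fin N) ℂ) : Prop :=
  ∃ (D : AdmissiblePair p) (x y : Fin N → ℂ) (b : ℕ) (l : ℂ),
    A = D.matrix x y ∧
    D.Y ∩ D.image = ∅ ∧
    D.bMinus ≤ b ∧ b < D.bPlus ∧
    (∀ i, pos i ≤ b → x i = l) ∧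
    (∀ i, b < pos i → x i = 0) ∧
    (∀ i ∈ D.Y, y i ≠ 0)

end GradedRE

end

/-!
The proof has three layers.

*Operators.* The graded tensor square acts faithfully on `V ⊗ V` (`act`, `act_injective`), where
`S` is a braiding with explicit entries. Comparing entries of `S (A₂ S A₂)` and `(A₂ S A₂) S` turns
the reflection equation into one scalar equation for every quadruple of indices
(`reflectionEquation_iff`). Besides products of two entries of `A` it contains only the truncated
products `∑_{m > c} A_{im} A_{mj}` (`tailProd`).

*Conditions on the entries.* The equation at `(a, a; k, k)` with `[a] ≠ [k]` reads
`(q + q⁻¹) A_{ak}² = 0` up to sign, so a solution is even; this is where `q² ≠ -1` enters. For even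
`A` the signs depending on the degrees of entries cancel, and a case analysis over the coincidences
among the four indices, using `q² ≠ 1`, shows that the equations are equivalent to `EntryConditions`
(`reflectionEquation_iff_entryConditions`): the off-diagonal part is the graph of a strictly
decreasing injective partial map `σ` for which every chain `j, σ(j), σ(σ(j))` is a 2-cycle, an
off-diagonal entry forces the diagonal to be `0` from its larger index on and constant up to its
smaller index, and for `a < b` the quadratic relation
`∑_{m > b} A_{am} A_{ma} - ∑_{m > a} A_{bm} A_{mb} + A_{aa} A_{bb} = 0` holds.

*Combinatorics.* Without 2-cycles the quadratic relation is `A_{bb} (A_{aa} - A_{bb}) = 0`, so the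
diagonal is `λ` up to some index and `0` afterwards: the second family (`EntryConditions.isType2`).
Otherwise let `a₀ < d₀` be the innermost 2-cycle. The relation at `(a, a₀)` shows that each `a < a₀`
starts a 2-cycle of the same weight `v = A_{a₀d₀} A_{d₀a₀}`, the relation at `(a, b)` with `b > d₀`
shows that the other ends fill an interval starting at `d₀`, and the relation at `(a₀, b)` with `b`
between `a₀` and `d₀` makes `A_{bb}` a nonzero root of `t² - A_{a₀a₀} t - v`. This leaves no room for
further off-diagonal entries and gives the first family (`IsInnermost.isType1`), with `λ` the root
and `μ = A_{a₀a₀} - λ`.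
-/

noncomputable section

namespace GradedRE

variable {N : ℕ}

/-! ### The action of the graded tensor square on `V ⊗ V` -/

/-- The sign `(-1)^d` as a complex number. -/
def chi (d : ZMod 2) : ℂ := (sgn d : ℂ)

theorem zmod_two_cases (d : ZMod 2) : d = 0 ∨ d = 1 := by
  revert d; decide

@[simp] theorem chi_zero : chi 0 = 1 := by simp [chi, sgn]

@[simp] theorem chi_one : chi 1 = -1 := by simp [chi, sgn]

theorem chi_add (d d' : ZMod 2) : chi (d + d') = chi d * chi d' := by
  have h : (1 : ZMod 2) + 1 = 0 := by decide
  rcases zmod_two_cases d with rfl | rfl <;> rcases zmod_two_cases d' with rfl | rfl <;> simp [h]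

theorem chi_mul_self (d : ZMod 2) : chi d * chi d = 1 := by
  rcases zmod_two_cases d with rfl | rfl <;> simp

theorem chi_ne_zero (d : ZMod 2) : chi d ≠ 0 := by
  rcases zmod_two_cases d with rfl | rfl <;> simp

theorem coe_neg_one_pow (d : ZMod 2) : (((-1 : ℤˣ) ^ d : ℤˣ) : ℤ) = sgn d := by
  rcases zmod_two_cases d with rfl | rfl
  · simp [sgn]
  · rw [uzpow_one]; simp [sgn]

/-- The action of `a ⊗ 1` on `V ⊗ V`, as a matrix indexed by pairs. -/
def actLeft : Matrix (Fin N) (Fin N) ℂ →ₐ[ℂ] Matrix (Fin N × Fin N) (Fin N × Fin N) ℂ :=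
  AlgHom.ofLinearMap
    { toFun := fun a => Matrix.of fun x y => if x.2 = y.2 then a x.1 y.1 else 0
      map_add' := by
        intro a b; ext x y; simp only [Matrix.of_apply, Matrix.add_apply]; split_ifs <;> simp
      map_smul' := by intro c a; ext x y; simp }
    (by
      ext ⟨x, x'⟩ ⟨y, y'⟩
      by_cases h : x = y <;> by_cases h' : x' = y' <;> simp [Matrix.one_apply, h, h'])
    (by
      intro a b
      ext ⟨x, x'⟩ ⟨y, y'⟩
      by_cases h : x' = y' <;>
        simp [Matrix.mul_apply, Fintype.sum_prod_type, h])

/-- The action of `1 ⊗ b` on `V ⊗ V`: a homogeneous `b` sends `v ⊗ w` to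
`(-1)^{deg b deg v} v ⊗ b w`. -/
def actRight (p : Fin N → ZMod 2) :
    Matrix (Fin N) (Fin N) ℂ →ₐ[ℂ] Matrix (Fin N × Fin N) (Fin N × Fin N) ℂ :=
  AlgHom.ofLinearMap
    { toFun := fun b => Matrix.of fun x y =>
        if x.1 = y.1 then b x.2 y.2 * chi ((p x.2 + p y.2) * p x.1) else 0
      map_add' := by
        intro a b; ext x y; simp only [Matrix.of_apply, Matrix.add_apply]
        split_ifs <;> simp [add_mul]
      map_smul' := by intro c a; ext x y; simp [mul_assoc] }
    (by
      ext ⟨x, x'⟩ ⟨y, y'⟩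
      by_cases h : x = y <;> by_cases h' : x' = y' <;>
        simp [Matrix.one_apply, h, h', CharTwo.add_self_eq_zero])
    (by
      intro a b
      ext ⟨x, x'⟩ ⟨y, y'⟩
      by_cases h : x = y
      · subst h
        simp only [LinearMap.coe_mk, AddHom.coe_mk, Matrix.of_apply, Matrix.mul_apply,
          Fintype.sum_prod_type, if_true]
        rw [Finset.sum_eq_single x
          (fun z _ hz => Finset.sum_eq_zero fun m _ => by rw [if_neg (Ne.symm hz), zero_mul])
          (by simp), Finset.sum_mul]
        refine Finset.sum_congr rfl fun m _ => ?_
        rw [if_pos rfl, if_pos rfl]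
        have h1 : (p x' + p y') * p x = (p x' + p m) * p x + (p m + p y') * p x := by
          have h2 : p m + p m = 0 := CharTwo.add_self_eq_zero _
          linear_combination (-p x) * h2
        rw [h1, chi_add]
        ring
      · simp only [LinearMap.coe_mk, AddHom.coe_mk, Matrix.of_apply, Matrix.mul_apply,
          Fintype.sum_prod_type]
        rw [if_neg h, eq_comm]
        refine Finset.sum_eq_zero fun z _ => Finset.sum_eq_zero fun m _ => ?_
        by_cases hz : x = z
        · subst hz; simp [h]
        · simp [hz])

theorem actLeft_apply (a : Matrix (Fin N) (Fin N) ℂ) (x x' y y' : Fin N) :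
    actLeft a (x, x') (y, y') = if x' = y' then a x y else 0 := rfl

theorem actRight_apply (p : Fin N → ZMod 2) (b : Matrix (Fin N) (Fin N) ℂ) (x x' y y' : Fin N) :
    actRight p b (x, x') (y, y') = if x = y then b x' y' * chi ((p x' + p y') * p x) else 0 := rfl

theorem actLeft_mul_actRight_apply (p : Fin N → ZMod 2) (a b : Matrix (Fin N) (Fin N) ℂ)
    (x x' y y' : Fin N) :
    (actLeft a * actRight p b) (x, x') (y, y') = a x y * b x' y' * chi ((p x' + p y') * p y) := by
  simp only [Matrix.mul_apply, Fintype.sum_prod_type, actLeft_apply, actRight_apply]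
  rw [Finset.sum_eq_single y (by intro z _ hz; simp [hz]) (by simp)]
  simp [mul_assoc]

theorem actRight_mul_actLeft_apply (p : Fin N → ZMod 2) (a b : Matrix (Fin N) (Fin N) ℂ)
    (x x' y y' : Fin N) :
    (actRight p b * actLeft a) (x, x') (y, y') = a x y * b x' y' * chi ((p x' + p y') * p x) := by
  simp only [Matrix.mul_apply, Fintype.sum_prod_type, actLeft_apply, actRight_apply]
  rw [Finset.sum_eq_single x (by intro z _ hz; simp [Ne.symm hz]) (by simp)]
  simp
  ring

/-- The algebra map from the graded tensor square to the operators on `V ⊗ V`. -/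
def act (p : Fin N → ZMod 2) : EndSq p →ₐ[ℂ] Matrix (Fin N × Fin N) (Fin N × Fin N) ℂ :=
  GradedTensorProduct.lift (grading p) (grading p) actLeft (actRight p) (by
    intro i j a b
    ext ⟨x, x'⟩ ⟨y, y'⟩
    rw [Units.smul_def, coe_neg_one_pow, ← Int.cast_smul_eq_zsmul ℂ, Matrix.smul_apply,
      actLeft_mul_actRight_apply, actRight_mul_actLeft_apply]
    by_cases ha : (a : Matrix (Fin N) (Fin N) ℂ) x y = 0
    · simp [ha]
    by_cases hb : (b : Matrix (Fin N) (Fin N) ℂ) x' y' = 0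
    · simp [hb]
    have h1 := a.2 x y ha
    have h2 := b.2 x' y' hb
    have h5 : ((sgn (j * i) : ℤ) : ℂ) = chi ((p x' + p y') * (p x + p y)) := by rw [h1, h2]; rfl
    rw [h5, smul_eq_mul]
    have h3 : (p x' + p y') * p y
        = (p x' + p y') * (p x + p y) + (p x' + p y') * p x := by
      have h4 : p x + p x = 0 := CharTwo.add_self_eq_zero _
      linear_combination (-(p x' + p y')) * h4
    rw [h3, chi_add]
    ring)

theorem act_tens_apply (p : Fin N → ZMod 2) (a b : Matrix (Fin N) (Fin N) ℂ)
    (x x' y y' : Fin N) :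
    act p (tens p a b) (x, x') (y, y') = a x y * b x' y' * chi ((p x' + p y') * p y) := by
  rw [act, GradedTensorProduct.lift_tmul, actLeft_mul_actRight_apply]

/-- The action of the graded tensor square on `V ⊗ V` is faithful: up to a sign, `e_{ij} ⊗ e_{kl}`
acts as a matrix unit. -/
theorem act_injective (p : Fin N → ZMod 2) : Function.Injective (act p) := by
  -- the inverse map, read off from the matrix entries
  let inv : Matrix (Fin N × Fin N) (Fin N × Fin N) ℂ →ₗ[ℂ] EndSq p :=
    ∑ x', ∑ y', ∑ x, ∑ y, LinearMap.smulRight (Matrix.entryLinearMap ℂ ℂ (x, x') (y, y'))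
      (chi ((p x' + p y') * p y) • tens p (e x y) (e x' y'))
  have hinv : inv ∘ₗ (act p).toLinearMap = LinearMap.id := by
    apply GradedTensorProduct.hom_ext
    apply TensorProduct.ext'
    intro a b
    have hl : inv (act p (tens p a b)) = ∑ x', ∑ y', ∑ x, ∑ y,
        (a x y * b x' y') • tens p (e x y) (e x' y') := by
      simp only [inv, LinearMap.sum_apply, LinearMap.smulRight_apply,
        Matrix.entryLinearMap_apply, act_tens_apply, smul_smul, mul_assoc, chi_mul_self, mul_one]
    have hr : tens p a b = ∑ x', ∑ y', ∑ x, ∑ y,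
        (a x y * b x' y') • tens p (e x y) (e x' y') := by
      have ha : a = ∑ x, ∑ y, a x y • e x y := by
        conv_lhs => rw [Matrix.matrix_eq_sum_single a]
        simp [e]
      have hb : b = ∑ x, ∑ y, b x y • e x y := by
        conv_lhs => rw [Matrix.matrix_eq_sum_single b]
        simp [e]
      conv_lhs => rw [ha, hb]
      simp only [tens, GradedTensorProduct.tmul, TensorProduct.sum_tmul, TensorProduct.tmul_sum,
        TensorProduct.smul_tmul_smul, map_sum, map_smul]
    exact hl.trans hr.symm
  intro u v huv
  have h : inv (act p u) = inv (act p v) := by rw [huv]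
  exact (LinearMap.congr_fun hinv u).symm.trans (h.trans (LinearMap.congr_fun hinv v))

/-! ### The reflection equation in components -/

/-- The eigenvalue `q^{(-1)^{[a]} δ_{ab}}` of the diagonal part of `R` on `v_a ⊗ v_b`. -/
def diagCoeff (p : Fin N → ZMod 2) (q : ℂ) (a b : Fin N) : ℂ :=
  q ^ (if a = b then sgn (p a) else 0)

theorem diagCoeff_of_ne (p : Fin N → ZMod 2) (q : ℂ) {a b : Fin N} (h : a ≠ b) :
    diagCoeff p q a b = 1 := by simp [diagCoeff, h]

theorem diagCoeff_comm (p : Fin N → ZMod 2) (q : ℂ) (a b : Fin N) :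
    diagCoeff p q a b = diagCoeff p q b a := by
  by_cases h : a = b
  · rw [h]
  · rw [diagCoeff_of_ne p q h, diagCoeff_of_ne p q (Ne.symm h)]

theorem act_flip_term_apply (p : Fin N → ZMod 2) (i j a b k l : Fin N) :
    act p ((sgn (p j) : ℂ) • tens p (e i j) (e j i)) (a, b) (k, l) =
      if i = a then if j = b then
        if b = k then if a = l then chi (p a * p b) else 0 else 0 else 0 else 0 := by
  rw [map_smul, Matrix.smul_apply, act_tens_apply]
  simp only [e, Matrix.single_apply]
  by_cases h1 : i = a
  · by_cases h2 : j = b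
    · by_cases h3 : b = k
      · by_cases h4 : a = l
        · subst h1 h2 h3 h4
          simp only [and_self, if_true, smul_eq_mul, one_mul]
          change chi (p j) * _ = _
          rcases zmod_two_cases (p i) with h | h <;> rcases zmod_two_cases (p j) with h' | h' <;>
            simp [h, h', show (1 : ZMod 2) + 1 = 0 from by decide]
        · simp [h1, h4]
      · simp [h2, h3]
    · simp [h2]
  · simp [h1]

theorem act_P_apply (p : Fin N → ZMod 2) (a b k l : Fin N) :
    act p (P p) (a, b) (k, l) = if b = k then if a = l then chi (p a * p b) else 0 else 0 := by
  simp only [P, map_sum, Matrix.sum_apply, act_flip_term_apply]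
  simp

theorem act_R_apply (p : Fin N → ZMod 2) (q : ℂ) (a b k l : Fin N) :
    act p (R p q) (a, b) (k, l) = (if a = k then if b = l then diagCoeff p q k l else 0 else 0) +
      (q - q⁻¹) * (if b = k then if a = l then
        (if k < l then chi (p a * p b) else 0) else 0 else 0) := by
  have h1 : ∀ i j : Fin N, act p ((q ^ (if i = j then sgn (p i) else 0)) •
      tens p (e i i) (e j j)) (a, b) (k, l) =
      if i = a then if j = b then
        (if a = k then if b = l then diagCoeff p q k l else 0 else 0) else 0 else 0 := by
    intro i j
    rw [map_smul, Matrix.smul_apply, act_tens_apply]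
    simp only [e, Matrix.single_apply]
    by_cases h1 : i = a
    · by_cases h2 : j = b
      · by_cases h3 : a = k
        · by_cases h4 : b = l
          · subst h1 h2 h3 h4
            simp [diagCoeff, CharTwo.add_self_eq_zero]
          · simp [h2, h4]
        · simp [h1, h3]
      · simp [h2]
    · simp [h1]
  rw [R, map_add, map_smul, Matrix.add_apply, Matrix.smul_apply, smul_eq_mul]
  congr 1
  · simp only [map_sum, Matrix.sum_apply, h1]
    simp
  · congr 1
    simp only [map_sum, Matrix.sum_apply, act_flip_term_apply]
    rw [Finset.sum_eq_single a (by
      intro i _ hi; exact Finset.sum_eq_zero fun j _ => by rw [if_neg hi]) (by simp)]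
    simp only [if_true, Finset.sum_ite_eq', Finset.mem_filter, Finset.mem_univ, true_and]
    by_cases hb : b = k
    · by_cases ha : a = l
      · subst hb ha; simp
      · simp [ha]
    · simp [hb]

theorem act_S_apply (p : Fin N → ZMod 2) (q : ℂ) (a b k l : Fin N) :
    act p (S p q) (a, b) (k, l) =
      (if b = k then if a = l then chi (p k * p l) * diagCoeff p q k l else 0 else 0) +
      (q - q⁻¹) * (if a = k then if b = l then (if k < l then 1 else 0) else 0 else 0) := by
  rw [S, map_mul, Matrix.mul_apply, Fintype.sum_prod_type]
  rw [Finset.sum_eq_single b (by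
      intro x _ hx
      exact Finset.sum_eq_zero fun y _ => by rw [act_P_apply, if_neg (Ne.symm hx), zero_mul])
    (by simp), Finset.sum_eq_single a (by
      intro y _ hy
      rw [act_P_apply, if_pos rfl, if_neg (Ne.symm hy), zero_mul]) (by simp),
    act_P_apply, if_pos rfl, if_pos rfl, act_R_apply]
  by_cases hk : b = k
  · by_cases hl : a = l
    · subst hk hl
      by_cases hab : a = b
      · subst hab; simp
      · simp [hab, mul_comm (p a)]
    · subst hk
      by_cases hab : a = b
      · subst hab; simp [hl]
      · simp [hl, hab]
  · by_cases hk' : a = k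
    · by_cases hl : b = l
      · subst hk' hl
        simp only [hk, if_false, if_true, zero_add]
        rw [mul_comm (p b)]
        split_ifs
        · linear_combination (q - q⁻¹) * chi_mul_self (p a * p b)
        · simp
      · simp [hk, hl]
    · simp [hk, hk']

/-- The truncated product `∑_{m > c} A_{im} A_{mj}`. -/
def tailProd (A : Matrix (Fin N) (Fin N) ℂ) (c i j : Fin N) : ℂ :=
  ∑ m, if c < m then A i m * A m j else 0

/-- The matrix entries of `A₂ S A₂` on `V ⊗ V`. -/
def sandwich (p : Fin N → ZMod 2) (q : ℂ) (A : Matrix (Fin N) (Fin N) ℂ) (a b k l : Fin N) : ℂ :=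
  A a l * A b k * chi (p a * p k + p l * p k + p a * p b) * diagCoeff p q k a +
    (q - q⁻¹) * (if a = k then
      chi ((p b + p l) * p k) * tailProd A k b l else 0)

theorem act_sandwich_apply (p : Fin N → ZMod 2) (q : ℂ) (A : Matrix (Fin N) (Fin N) ℂ)
    (a b k l : Fin N) :
    act p (tens p 1 A * S p q * tens p 1 A) (a, b) (k, l) = sandwich p q A a b k l := by
  have h1 : ∀ m n : Fin N, act p (tens p 1 A * S p q) (a, b) (m, n) =
      (A b m * chi ((p b + p m) * p a)) *
        (if a = n then chi (p m * p n) * diagCoeff p q m n else 0) +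
      (q - q⁻¹) * (if a = m then A b n * chi ((p b + p n) * p a) *
        (if m < n then 1 else 0) else 0) := by
    intro m n
    rw [map_mul, Matrix.mul_apply, Fintype.sum_prod_type]
    simp only [act_tens_apply, act_S_apply, Matrix.one_apply, ite_mul, one_mul, zero_mul]
    rw [Finset.sum_eq_single a (by
      intro x _ hx; exact Finset.sum_eq_zero fun j _ => by rw [if_neg (Ne.symm hx)]) (by simp)]
    simp only [if_true, mul_add, Finset.sum_add_distrib]
    congr 1
    · rw [Finset.sum_eq_single m (by intro x _ hx; simp [hx]) (by simp), if_pos rfl]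
    · rw [Finset.sum_eq_single n (by intro x _ hx; simp [hx]) (by simp), if_pos rfl]
      split_ifs <;> ring
  rw [map_mul, Matrix.mul_apply, Fintype.sum_prod_type]
  simp only [act_tens_apply, h1, Matrix.one_apply, ite_mul, one_mul, zero_mul, mul_ite, mul_zero]
  rw [Finset.sum_eq_single k (by
      intro x _ hx; exact Finset.sum_eq_zero fun j _ => by rw [if_neg hx]) (by simp)]
  simp only [if_true, add_mul, Finset.sum_add_distrib, sandwich]
  congr 1
  · rw [Finset.sum_eq_single a (by intro x _ hx; simp [Ne.symm hx]) (by simp), if_pos rfl,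
      diagCoeff_comm p q k a]
    have h : chi (p a * p k + p l * p k + p a * p b) =
        chi ((p b + p k) * p a) * chi (p k * p a) * chi ((p a + p l) * p k) := by
      rw [← chi_add, ← chi_add]
      congr 1
      have h2 : p k * p a + p k * p a = 0 := CharTwo.add_self_eq_zero _
      linear_combination -h2
    rw [h]
    simp only [add_mul]
    ring
  · by_cases hak : a = k
    · subst hak
      simp only [if_true, tailProd, Finset.mul_sum]
      refine Finset.sum_congr rfl fun m _ => ?_
      have h : chi ((p b + p l) * p a) = chi ((p b + p m) * p a) * chi ((p m + p l) * p a) := by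
        rw [← chi_add]
        congr 1
        have h2 : p m * p a + p m * p a = 0 := CharTwo.add_self_eq_zero _
        linear_combination -h2
      simp only [add_mul] at h ⊢
      split_ifs
      · linear_combination (-(q - q⁻¹) * A b m * A m l) * h
      · ring
    · simp [hak]

theorem reflectionEquation_iff (p : Fin N → ZMod 2) (q : ℂ) (A : Matrix (Fin N) (Fin N) ℂ) :
    ReflectionEquation p q A ↔ ∀ a b k l : Fin N,
      chi (p a * p b) * diagCoeff p q a b * sandwich p q A b a k l -
        chi (p k * p l) * diagCoeff p q k l * sandwich p q A a b l k +
        (q - q⁻¹) * ((if a < b then 1 else 0) - (if k < l then 1 else 0)) *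
          sandwich p q A a b k l = 0 := by
  have h1 : ReflectionEquation p q A ↔
      act p (S p q) * act p (tens p 1 A * S p q * tens p 1 A) =
        act p (tens p 1 A * S p q * tens p 1 A) * act p (S p q) := by
    rw [← map_mul, ← map_mul, (act_injective p).eq_iff, ReflectionEquation]
    simp only [mul_assoc]
  have hl : ∀ a b k l : Fin N,
      (act p (S p q) * act p (tens p 1 A * S p q * tens p 1 A)) (a, b) (k, l) =
        chi (p a * p b) * diagCoeff p q a b * sandwich p q A b a k l +
          (q - q⁻¹) * (if a < b then 1 else 0) * sandwich p q A a b k l := by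
    intro a b k l
    rw [Matrix.mul_apply, Fintype.sum_prod_type]
    simp only [act_S_apply, act_sandwich_apply, add_mul, Finset.sum_add_distrib]
    congr 1
    · rw [Finset.sum_eq_single b (by intro x _ hx; simp [Ne.symm hx]) (by simp),
        Finset.sum_eq_single a (by intro x _ hx; simp [Ne.symm hx]) (by simp)]
      simp only [if_true]
      rw [mul_comm (p a), diagCoeff_comm]
    · rw [Finset.sum_eq_single a (by intro x _ hx; simp [Ne.symm hx]) (by simp),
        Finset.sum_eq_single b (by intro x _ hx; simp [Ne.symm hx]) (by simp)]
      simp only [if_true]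
  have hr : ∀ a b k l : Fin N,
      (act p (tens p 1 A * S p q * tens p 1 A) * act p (S p q)) (a, b) (k, l) =
        chi (p k * p l) * diagCoeff p q k l * sandwich p q A a b l k +
          (q - q⁻¹) * (if k < l then 1 else 0) * sandwich p q A a b k l := by
    intro a b k l
    rw [Matrix.mul_apply, Fintype.sum_prod_type]
    simp only [act_S_apply, act_sandwich_apply, mul_add, Finset.sum_add_distrib]
    congr 1
    · rw [Finset.sum_eq_single l (by intro x _ hx; simp [hx]) (by simp),
        Finset.sum_eq_single k (by intro x _ hx; simp [hx]) (by simp)]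
      simp only [if_true]
      ring
    · rw [Finset.sum_eq_single k (by intro x _ hx; simp [hx]) (by simp),
        Finset.sum_eq_single l (by intro x _ hx; simp [hx]) (by simp)]
      simp only [if_true]
      ring
  rw [h1]
  constructor
  · intro h a b k l
    have h2 := congrFun (congrFun h (a, b)) (k, l)
    rw [hl, hr] at h2
    linear_combination h2
  · intro h
    ext ⟨a, b⟩ ⟨k, l⟩
    rw [hl, hr]
    linear_combination h a b k l

/-! ### Solutions are even -/

theorem sub_inv_ne_zero {q : ℂ} (hq : q ≠ 0) (hq4 : q ^ 4 ≠ 1) : q - q⁻¹ ≠ 0 := by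
  intro h
  apply hq4
  have h1 : q * q = 1 := by
    have := mul_inv_cancel₀ hq
    linear_combination q * h + this
  linear_combination (q * q + 1) * h1

theorem add_inv_ne_zero {q : ℂ} (hq : q ≠ 0) (hq4 : q ^ 4 ≠ 1) : q + q⁻¹ ≠ 0 := by
  intro h
  apply hq4
  have h1 : q * q = -1 := by
    have := mul_inv_cancel₀ hq
    linear_combination q * h - this
  linear_combination (q * q - 1) * h1

theorem diagCoeff_self (p : Fin N → ZMod 2) (q : ℂ) (a : Fin N) :
    diagCoeff p q a a = if p a = 0 then q else q⁻¹ := by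
  by_cases h : p a = 0 <;> simp [diagCoeff, sgn, h]

/-- The component of the reflection equation at `(a, a; k, k)` reads `±(q + q⁻¹) A_{ak}² = 0`
if `[a] ≠ [k]`. -/
theorem ReflectionEquation.apply_eq_zero {p : Fin N → ZMod 2} {q : ℂ} (hq : q ≠ 0)
    (hq4 : q ^ 4 ≠ 1) {A : Matrix (Fin N) (Fin N) ℂ} (h : ReflectionEquation p q A)
    {a k : Fin N} (hak : p a ≠ p k) : A a k = 0 := by
  have h1 := (reflectionEquation_iff p q A).1 h a a k k
  have hne : a ≠ k := fun h => hak (by rw [h])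
  have h2 := add_inv_ne_zero hq hq4
  have h11 : (1 : ZMod 2) + 1 = 0 := by decide
  simp only [sandwich, hne, if_false, lt_self_iff_false, sub_self, mul_zero, zero_mul, add_zero,
    diagCoeff_of_ne p q (Ne.symm hne), diagCoeff_self] at h1
  have h3 : (q + q⁻¹) * (A a k * A a k) = 0 := by
    rcases zmod_two_cases (p a) with ha | ha <;> rcases zmod_two_cases (p k) with hk | hk
    · exact absurd (ha.trans hk.symm) hak
    · simp [ha, hk] at h1
      linear_combination -h1
    · simp [ha, hk] at h1
      linear_combination h1
    · exact absurd (ha.trans hk.symm) hak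
  exact mul_self_eq_zero.1 ((mul_eq_zero.1 h3).resolve_left h2)

theorem mem_grading_zero_iff (p : Fin N → ZMod 2) (A : Matrix (Fin N) (Fin N) ℂ) :
    A ∈ grading p 0 ↔ ∀ i j, A i j ≠ 0 → p i = p j := by
  rw [mem_grading]
  refine forall₂_congr fun i j => imp_congr_right fun _ => ?_
  rw [CharTwo.add_eq_zero]

/-! ### The reflection equation for an even matrix -/

section Even

variable {p : Fin N → ZMod 2} {q : ℂ} {A : Matrix (Fin N) (Fin N) ℂ}

theorem tailProd_eq_zero_of_parity (hA : ∀ i j, A i j ≠ 0 → p i = p j) {c i j : Fin N}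
    (h : p i ≠ p j) : tailProd A c i j = 0 := by
  refine Finset.sum_eq_zero fun m _ => ?_
  split_ifs
  · by_contra h'
    exact h ((hA i m (left_ne_zero_of_mul h')).trans (hA m j (right_ne_zero_of_mul h')))
  · rfl

theorem sandwich_of_even (hA : ∀ i j, A i j ≠ 0 → p i = p j) (a b k l : Fin N) :
    sandwich p q A a b k l = chi (p a * p b) * diagCoeff p q k a * (A a l * A b k) +
      (q - q⁻¹) * (if a = k then tailProd A k b l else 0) := by
  rw [sandwich]
  congr 1
  · by_cases h : A a l * A b k = 0
    · rw [h]; ring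
    · have h1 := hA a l (left_ne_zero_of_mul h)
      have h2 := hA b k (right_ne_zero_of_mul h)
      have h3 : p a * p k + p l * p k + p a * p b = p a * p b := by
        rw [← h1, CharTwo.add_self_eq_zero, zero_add]
      rw [h3]; ring
  · congr 1
    split_ifs
    · by_cases h : p b = p l
      · rw [h, CharTwo.add_self_eq_zero, zero_mul, chi_zero, one_mul]
      · rw [tailProd_eq_zero_of_parity hA h, mul_zero]
    · rfl

/-- One component of the reflection equation for an even matrix; the signs that depend on the
degrees of the entries have dropped out. -/
def evenComponent (p : Fin N → ZMod 2) (q : ℂ) (A : Matrix (Fin N) (Fin N) ℂ)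
    (a b k l : Fin N) : ℂ :=
  (diagCoeff p q a b * diagCoeff p q k b - diagCoeff p q k l * diagCoeff p q l a) *
      (A a k * A b l) +
    (q - q⁻¹) * diagCoeff p q a b * chi (p a * p b) * (if b = k then tailProd A k a l else 0) -
    (q - q⁻¹) * diagCoeff p q k l * chi (p k * p l) * (if a = l then tailProd A l b k else 0) +
    (q - q⁻¹) * ((if a < b then 1 else 0) - (if k < l then 1 else 0)) *
      (chi (p a * p b) * diagCoeff p q k a * (A a l * A b k) +
        (q - q⁻¹) * (if a = k then tailProd A k b l else 0))

theorem reflectionEquation_iff_of_even (hA : ∀ i j, A i j ≠ 0 → p i = p j) :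
    ReflectionEquation p q A ↔ ∀ a b k l, evenComponent p q A a b k l = 0 := by
  rw [reflectionEquation_iff]
  refine forall₄_congr fun a b k l => ?_
  simp only [sandwich_of_even hA]
  have h1 := chi_mul_self (p a * p b)
  have h2 : chi (p k * p l) * chi (p a * p b) * (A a k * A b l) = A a k * A b l := by
    by_cases h : A a k * A b l = 0
    · rw [h, mul_zero]
    · rw [hA a k (left_ne_zero_of_mul h), hA b l (right_ne_zero_of_mul h), chi_mul_self, one_mul]
  refine Eq.congr ?_ rfl
  rw [evenComponent, mul_comm (p b)]
  linear_combination (diagCoeff p q a b * diagCoeff p q k b * (A a k * A b l)) * h1 -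
    diagCoeff p q k l * diagCoeff p q l a * h2

/-! ### Reduction to conditions on the entries -/

/-- The conditions on the entries of an even matrix to which the reflection equation boils down.
The first four say that the off-diagonal part is the graph of a strictly decreasing injective
partial map without chains `j → c → i` through three distinct indices. -/
structure EntryConditions (A : Matrix (Fin N) (Fin N) ℂ) : Prop where
  row : ∀ a k l, a ≠ k → a ≠ l → k ≠ l → A a k * A a l = 0
  col : ∀ a b k, a ≠ k → b ≠ k → a ≠ b → A a k * A b k = 0
  chain : ∀ i c j, i ≠ c → c ≠ j → i ≠ j → A i c * A c j = 0
  anti : ∀ a b k l, a < b → l < k → a ≠ l → b ≠ k → A a l * A b k = 0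
  above : ∀ i j c, i ≠ j → A i j ≠ 0 → i ≤ c → j ≤ c → A c c = 0
  below : ∀ i j c, i ≠ j → A i j ≠ 0 → c < i → c < j → A c c = A i i + A j j
  diag : ∀ a b, a < b → tailProd A b a a - tailProd A a b b + A a a * A b b = 0

theorem diagCoeff_self_mul_self (hq : q ≠ 0) (a : Fin N) :
    diagCoeff p q a a * diagCoeff p q a a =
      1 + chi (p a * p a) * (q - q⁻¹) * diagCoeff p q a a := by
  have h := mul_inv_cancel₀ hq
  rw [diagCoeff_self]
  rcases zmod_two_cases (p a) with ha | ha
  · simp only [ha, if_true, mul_zero, chi_zero]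
    linear_combination h
  · simp only [ha, one_ne_zero, if_false, mul_one, chi_one]
    linear_combination h

theorem diagCoeff_self_ne_one (hq : q ≠ 0) (hq4 : q ^ 4 ≠ 1) (a : Fin N) :
    diagCoeff p q a a ≠ 1 := by
  intro h
  have h1 := diagCoeff_self_mul_self (p := p) hq a
  rw [h] at h1
  apply mul_ne_zero (chi_ne_zero (p a * p a)) (sub_inv_ne_zero hq hq4)
  linear_combination -h1

theorem diagCoeff_self_ne_zero (hq : q ≠ 0) (a : Fin N) : diagCoeff p q a a ≠ 0 :=
  zpow_ne_zero _ hq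

theorem diagCoeff_self_congr {a b : Fin N} (h : p a = p b) :
    diagCoeff p q a a = diagCoeff p q b b := by
  rw [diagCoeff_self, diagCoeff_self, h]

/-- Without chains an off-diagonal entry of the truncated square has at most two terms. -/
theorem tailProd_of_chain (h : ∀ i c j, i ≠ c → c ≠ j → i ≠ j → A i c * A c j = 0)
    (c : Fin N) {i j : Fin N} (hij : i ≠ j) :
    tailProd A c i j = ((if c < i then A i i else 0) + (if c < j then A j j else 0)) * A i j := by
  have h1 : ∀ m, (if c < m then A i m * A m j else 0) =
      (if m = i then (if c < i then A i i else 0) * A i j else 0) +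
        (if m = j then (if c < j then A j j else 0) * A i j else 0) := by
    intro m
    by_cases hi : m = i
    · subst hi
      simp [hij]
    · by_cases hj : m = j
      · subst hj
        simp [hi, mul_comm]
      · simp [hi, hj, h i m j (Ne.symm hi) hj hij]
  rw [tailProd, Finset.sum_congr rfl fun m _ => h1 m, Finset.sum_add_distrib]
  simp [add_mul]

/-- If `A_{ic}` is the only off-diagonal entry in its row, or `A_{cj}` in its column, the chain
`j → c → i` is the only term of the truncated square at `(i, j)`. -/
theorem tailProd_of_chain_term {i c j : Fin N} (hij : A i j = 0)
    (h : ∀ m, m ≠ i → m ≠ j → m ≠ c → A i m * A m j = 0) (d : Fin N) :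
    tailProd A d i j = if d < c then A i c * A c j else 0 := by
  rw [tailProd, Finset.sum_eq_single c]
  · intro m _ hm
    by_cases hi : m = i
    · simp [hi, hij]
    · by_cases hj : m = j
      · simp [hj, hij]
      · simp [h m hi hj hm]
  · simp

section Necessity

variable (hq : q ≠ 0) (hq4 : q ^ 4 ≠ 1) (hA : ∀ i j, A i j ≠ 0 → p i = p j)
  (h : ∀ a b k l, evenComponent p q A a b k l = 0)

include hq hq4 h in
theorem row_of_evenComponent (a k l : Fin N) (hak : a ≠ k) (hal : a ≠ l) (hkl : k ≠ l) :
    A a k * A a l = 0 := by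
  have h1 := h a a k l
  have hg := diagCoeff_self_mul_self (p := p) hq a
  have hg1 := sub_ne_zero.2 (diagCoeff_self_ne_one (p := p) hq hq4 a)
  have hg0 := diagCoeff_self_ne_zero (p := p) hq a
  simp only [evenComponent, hak, hal, if_false, diagCoeff_of_ne p q hak.symm,
    diagCoeff_of_ne p q hal.symm, diagCoeff_of_ne p q hkl, lt_self_iff_false] at h1
  by_cases hlt : k < l
  · simp only [hlt, if_true] at h1
    refine (mul_eq_zero.1 ?_).resolve_left hg1
    linear_combination (-diagCoeff p q a a) * h1 + A a k * A a l * hg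
  · simp only [hlt, if_false] at h1
    refine (mul_eq_zero.1 ?_).resolve_left hg1
    linear_combination h1

include hq hq4 hA h in
theorem col_of_evenComponent (a b k : Fin N) (hak : a ≠ k) (hbk : b ≠ k) (hab : a ≠ b) :
    A a k * A b k = 0 := by
  by_contra hne
  have h1 := h a b k k
  have hg := diagCoeff_self_mul_self (p := p) hq k
  have hg1 := sub_ne_zero.2 (diagCoeff_self_ne_one (p := p) hq hq4 k)
  simp only [evenComponent, hak, hbk, if_false, diagCoeff_of_ne p q hbk.symm,
    diagCoeff_of_ne p q hak.symm, diagCoeff_of_ne p q hab, lt_self_iff_false,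
    hA a k (left_ne_zero_of_mul hne), hA b k (right_ne_zero_of_mul hne)] at h1
  apply hne
  by_cases hlt : a < b
  · simp only [hlt, if_true] at h1
    refine (mul_eq_zero.1 ?_).resolve_left hg1
    linear_combination (diagCoeff p q k k) * h1 + A a k * A b k * hg
  · simp only [hlt, if_false] at h1
    refine (mul_eq_zero.1 ?_).resolve_left hg1
    linear_combination -h1

include hq hq4 h in
/-- The component at `(a, a; a, l)`. -/
theorem tailProd_self_left {a l : Fin N} (hal : a ≠ l) :
    tailProd A a a l + (if l < a then A a a * A a l else 0) = 0 := by
  have h1 := h a a a l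
  have hg := diagCoeff_self_mul_self (p := p) hq a
  have hw := sub_inv_ne_zero hq hq4
  have hg0 := diagCoeff_self_ne_zero (p := p) hq a
  have hs := chi_ne_zero (p a * p a)
  have hss := chi_mul_self (p a * p a)
  simp only [evenComponent, hal, if_false, if_true, diagCoeff_of_ne p q hal,
    diagCoeff_of_ne p q hal.symm, lt_self_iff_false] at h1
  rcases lt_or_gt_of_ne hal with hlt | hlt
  · simp only [hlt, not_lt_of_gt hlt, if_true, if_false] at h1 ⊢
    -- the coefficient of the truncated square is `w (s g - w)`, where `w = q - q⁻¹`,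
    -- `s = chi (p a * p a)`, `g = diagCoeff p q a a`; it is nonzero since `(s g - w) g = s`
    refine (mul_eq_zero.1 ?_).resolve_left (mul_ne_zero hw hs)
    linear_combination diagCoeff p q a a * h1 - ((q - q⁻¹) * chi (p a * p a) * tailProd A a a l +
      diagCoeff p q a a * A a a * A a l) * hg + (q - q⁻¹) ^ 2 * diagCoeff p q a a *
        tailProd A a a l * (-hss)
  · simp only [hlt, not_lt_of_gt hlt, if_true, if_false] at h1 ⊢
    refine (mul_eq_zero.1 ?_).resolve_left (mul_ne_zero (mul_ne_zero hw hg0) hs)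
    linear_combination h1 - A a a * A a l * hg

include hq hq4 hA h in
/-- The component at `(a, b; a, a)`. -/
theorem tailProd_self_right {a b : Fin N} (hab : a ≠ b) :
    tailProd A a b a + (if b < a then A a a * A b a else 0) = 0 := by
  have h1 := h a b a a
  have hg := diagCoeff_self_mul_self (p := p) hq a
  have hw := sub_inv_ne_zero hq hq4
  have hg0 := diagCoeff_self_ne_zero (p := p) hq a
  have hs := chi_ne_zero (p a * p a)
  have hss := chi_mul_self (p a * p a)
  have hp : chi (p a * p b) * A b a = chi (p a * p a) * A b a := by
    by_cases hz : A b a = 0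
    · rw [hz]; ring
    · rw [hA b a hz]
  simp only [evenComponent, hab.symm, if_false, if_true, diagCoeff_of_ne p q hab,
    lt_self_iff_false] at h1
  rcases lt_or_gt_of_ne hab with hlt | hlt
  · simp only [hlt, not_lt_of_gt hlt, if_true, if_false] at h1 ⊢
    refine (mul_eq_zero.1 ?_).resolve_left (mul_ne_zero hw hs)
    linear_combination (-diagCoeff p q a a) * h1 + (q - q⁻¹) * diagCoeff p q a a ^ 2 *
      A a a * hp - ((q - q⁻¹) * chi (p a * p a) * tailProd A a b a +
      diagCoeff p q a a * A a a * A b a) * hg + (q - q⁻¹) ^ 2 * diagCoeff p q a a *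
        tailProd A a b a * (-hss)
  · simp only [hlt, not_lt_of_gt hlt, if_true, if_false] at h1 ⊢
    refine (mul_eq_zero.1 ?_).resolve_left (mul_ne_zero (mul_ne_zero hw hg0) hs)
    linear_combination -h1 - A a a * A b a * hg

include h in
/-- The component at `(i, c; c, j)`. -/
theorem component_of_middle {c i j : Fin N} (hic : i ≠ c) (hcj : c ≠ j) (hij : i ≠ j) :
    (diagCoeff p q c c - 1) * (A i c * A c j) + (q - q⁻¹) * chi (p i * p c) *
      (tailProd A c i j + ((if i < c then 1 else 0) - (if c < j then 1 else 0)) *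
        (A c c * A i j)) = 0 := by
  have h1 := h i c c j
  simp only [evenComponent, hic, hij, if_false, if_true, diagCoeff_of_ne p q hic,
    diagCoeff_of_ne p q hcj, diagCoeff_of_ne p q hij.symm, diagCoeff_of_ne p q hic.symm] at h1
  linear_combination h1

include hq hq4 hA h in
/-- A chain `j → c → i` has `c < i` and `c < j` by the components at `(i, i; i, j)` and
`(j, i; j, j)`, and then the component at `(i, c; c, j)` excludes it since `g ≠ 1` for
`g = diagCoeff p q c c`. -/
theorem chain_of_evenComponent (i c j : Fin N) (hic : i ≠ c) (hcj : c ≠ j) (hij : i ≠ j) :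
    A i c * A c j = 0 := by
  by_contra hne
  have hrow := row_of_evenComponent hq hq4 h
  have hic0 := left_ne_zero_of_mul hne
  have hij0 : A i j = 0 := (mul_eq_zero.1 (hrow i c j hic hij hcj)).resolve_left hic0
  have htail : ∀ d, tailProd A d i j = if d < c then A i c * A c j else 0 :=
    tailProd_of_chain_term hij0 fun m hmi _ hmc => by
      rw [(mul_eq_zero.1 (hrow i c m hic hmi.symm hmc.symm)).resolve_left hic0, zero_mul]
  have h1 := tailProd_self_left hq hq4 h hij
  have h2 := tailProd_self_right hq hq4 hA h hij.symm
  rw [htail, hij0, mul_zero, ite_self, add_zero, ite_eq_right_iff] at h1 h2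
  have hci : c < i := lt_of_le_of_ne (not_lt.1 fun h => hne (h1 h)) hic.symm
  have hcj' : c < j := lt_of_le_of_ne (not_lt.1 fun h => hne (h2 h)) hcj
  have h3 := component_of_middle h hic hcj hij
  rw [htail, hij0, if_neg (lt_irrefl c)] at h3
  refine hne ((mul_eq_zero.1 ?_).resolve_left
    (sub_ne_zero.2 (diagCoeff_self_ne_one (p := p) hq hq4 c)))
  linear_combination h3

include hq hq4 hA h in
/-- The component at `(i, c; c, j)` once chains are excluded. -/
theorem diag_mul_of_evenComponent {c i j : Fin N} (hic : i ≠ c) (hcj : c ≠ j) (hij : i ≠ j)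
    (hne : A i j ≠ 0) :
    (if c < i then A i i else 0) + (if c < j then A j j else 0) +
      ((if i < c then 1 else 0) - (if c < j then 1 else 0)) * A c c = 0 := by
  have h1 := component_of_middle h hic hcj hij
  have hchain := chain_of_evenComponent hq hq4 hA h
  rw [hchain i c j hic hcj hij, mul_zero, zero_add, tailProd_of_chain hchain c hij] at h1
  have h2 := (mul_eq_zero.1 h1).resolve_left
    (mul_ne_zero (sub_inv_ne_zero hq hq4) (chi_ne_zero _))
  refine (mul_eq_zero.1 ?_).resolve_right hne
  linear_combination h2

include hq hq4 hA h in
theorem entryConditions_of_evenComponent : EntryConditions A where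
  row := row_of_evenComponent hq hq4 h
  col := col_of_evenComponent hq hq4 hA h
  chain := chain_of_evenComponent hq hq4 hA h
  anti := by
    intro a b k l hab hlk hal hbk
    by_cases hak : a = k
    · subst hak
      have hbl : b ≠ l := (hlk.trans hab).ne'
      rw [mul_comm]
      exact chain_of_evenComponent hq hq4 hA h b a l hab.ne' hal hbl
    by_cases hbl : b = l
    · subst hbl
      exact chain_of_evenComponent hq hq4 hA h a b k hab.ne hbk hak
    have h1 := h a b k l
    simp only [evenComponent, hak, hal, hbk, if_false, diagCoeff_of_ne p q hab.ne,
      diagCoeff_of_ne p q (Ne.symm hbk), diagCoeff_of_ne p q hlk.ne',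
      diagCoeff_of_ne p q (Ne.symm hal), diagCoeff_of_ne p q (Ne.symm hak), hab, if_true,
      not_lt_of_gt hlk] at h1
    refine (mul_eq_zero.1 ?_).resolve_left
      (mul_ne_zero (sub_inv_ne_zero hq hq4) (chi_ne_zero (p a * p b)))
    linear_combination h1
  above := by
    intro i j c hij hne hic hjc
    have hchain := chain_of_evenComponent hq hq4 hA h
    rcases eq_or_lt_of_le hic with rfl | hic
    · have hji := lt_of_le_of_ne hjc hij.symm
      have h1 := tailProd_self_right hq hq4 hA h hij.symm
      rw [tailProd_of_chain hchain _ hij] at h1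
      simp only [hji, not_lt_of_gt hji, lt_irrefl, if_true, if_false, add_zero] at h1
      exact (mul_eq_zero.1 h1).resolve_right hne
    rcases eq_or_lt_of_le hjc with rfl | hjc
    · have h1 := tailProd_self_left hq hq4 h hij
      rw [tailProd_of_chain hchain _ hij] at h1
      simp only [hic, not_lt_of_gt hic, lt_irrefl, if_true, if_false, add_zero, zero_add] at h1
      exact (mul_eq_zero.1 h1).resolve_right hne
    have h1 := diag_mul_of_evenComponent hq hq4 hA h hic.ne hjc.ne' hij hne
    simpa only [hic, not_lt_of_gt hic, not_lt_of_gt hjc, if_true, if_false, sub_zero, one_mul,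
      zero_add] using h1
  below := by
    intro i j c hij hne hci hcj
    have h1 := diag_mul_of_evenComponent hq hq4 hA h hci.ne' hcj.ne hij hne
    simp only [hci, not_lt_of_gt hci, hcj, if_true, if_false] at h1
    linear_combination -h1
  diag := by
    intro a b hab
    have h1 := h a b b a
    have hp : (diagCoeff p q b b - diagCoeff p q a a) * (A a b * A b a) = 0 := by
      by_cases hz : A a b = 0
      · rw [hz]; ring
      · rw [diagCoeff_self_congr (hA a b hz)]; ring
    simp only [evenComponent, if_false, if_true, diagCoeff_of_ne p q hab.ne,
      diagCoeff_of_ne p q hab.ne', hab, not_lt_of_gt hab, hab.ne, mul_comm (p b)] at h1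
    refine (mul_eq_zero.1 ?_).resolve_left
      (mul_ne_zero (sub_inv_ne_zero hq hq4) (chi_ne_zero (p a * p b)))
    linear_combination h1 - hp

end Necessity

section Sufficiency

variable (hA : ∀ i j, A i j ≠ 0 → p i = p j) (h : EntryConditions A)

include h in
theorem EntryConditions.tailProd_self_left {a l : Fin N} (hal : a ≠ l) :
    tailProd A a a l = -(if l < a then A a a * A a l else 0) := by
  rw [tailProd_of_chain h.chain a hal]
  by_cases hz : A a l = 0
  · simp [hz]
  rcases lt_or_gt_of_ne hal with hlt | hlt
  · simp [hlt, not_lt_of_gt hlt, h.above a l l hal hz hlt.le le_rfl]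
  · simp [not_lt_of_gt hlt, h.above a l a hal hz le_rfl hlt.le]

include h in
theorem EntryConditions.tailProd_self_right {a b : Fin N} (hab : a ≠ b) :
    tailProd A a b a = -(if b < a then A a a * A b a else 0) := by
  rw [tailProd_of_chain h.chain a hab.symm]
  by_cases hz : A b a = 0
  · simp [hz]
  rcases lt_or_gt_of_ne hab with hlt | hlt
  · simp [hlt, not_lt_of_gt hlt, h.above b a b hab.symm hz le_rfl hlt.le]
  · simp [not_lt_of_gt hlt, h.above b a a hab.symm hz hlt.le le_rfl]

include h in
theorem EntryConditions.tailProd_middle {c i j : Fin N} (hic : i ≠ c) (hcj : c ≠ j) (hij : i ≠ j) :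
    tailProd A c i j =
      -((if i < c then 1 else 0) - (if c < j then 1 else 0)) * (A c c * A i j) := by
  rw [tailProd_of_chain h.chain c hij]
  by_cases hz : A i j = 0
  · simp [hz]
  rcases lt_or_gt_of_ne hic with h1 | h1 <;> rcases lt_or_gt_of_ne hcj with h2 | h2
  · simp [h1, h2, not_lt_of_gt h1, h.above i j j hij hz (h1.trans h2).le le_rfl]
  · simp [h1, not_lt_of_gt h1, not_lt_of_gt h2, h.above i j c hij hz h1.le h2.le]
  · simp [h1, h2, not_lt_of_gt h1, h.below i j c hij hz h1 h2]
  · simp [h1, not_lt_of_gt h1, not_lt_of_gt h2, h.above i j i hij hz le_rfl (h2.trans h1).le]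

include hA h in
theorem EntryConditions.evenComponent_eq_zero (hq : q ≠ 0) (a b k l : Fin N) :
    evenComponent p q A a b k l = 0 := by
  have hg := diagCoeff_self_mul_self (p := p) hq
  have hgc : ∀ i j : Fin N, A i j ≠ 0 → diagCoeff p q i i = diagCoeff p q j j :=
    fun i j hij => diagCoeff_self_congr (hA i j hij)
  have hp : ∀ i j : Fin N, chi (p i * p j) * A i j = chi (p i * p i) * A i j := by
    intro i j
    by_cases hz : A i j = 0
    · rw [hz]; ring
    · rw [hA i j hz]
  have hp' : ∀ i j : Fin N, chi (p i * p j) * A i j = chi (p j * p j) * A i j := by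
    intro i j
    by_cases hz : A i j = 0
    · rw [hz]; ring
    · rw [hA i j hz]
  by_cases hab : a = b
  · subst hab
    by_cases hkl : k = l
    · subst hkl
      by_cases hak : a = k
      · subst hak
        simp only [evenComponent, if_true, lt_irrefl]
        ring
      · have hz : (diagCoeff p q a a - diagCoeff p q k k) * A a k = 0 := by
          by_cases hz : A a k = 0
          · rw [hz]; ring
          · rw [hgc a k hz]; ring
        simp only [evenComponent, hak, if_false, lt_irrefl, diagCoeff_of_ne p q (Ne.symm hak)]
        linear_combination A a k * hz
    · by_cases hak : a = k
      · subst hak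
        simp only [evenComponent, hkl, if_true, if_false, lt_irrefl, h.tailProd_self_left hkl,
          diagCoeff_of_ne p q (Ne.symm hkl), diagCoeff_of_ne p q hkl]
        rcases lt_or_gt_of_ne hkl with hlt | hlt
        · simp only [hlt, not_lt_of_gt hlt, if_true, if_false]
          linear_combination A a a * A a l * hg a
        · simp only [hlt, not_lt_of_gt hlt, if_true, if_false]
          linear_combination A a a * A a l * hg a
      · by_cases hal : a = l
        · subst hal
          simp only [evenComponent, hak, if_true, if_false, lt_irrefl,
            h.tailProd_self_left hak, diagCoeff_of_ne p q hkl]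
          rw [mul_comm (p k)]
          split_ifs
          · linear_combination (q - q⁻¹) * A a a * hp a k
          · ring
        · have hz := h.row a k l hak hal hkl
          have hz' := h.row a l k hal hak (Ne.symm hkl)
          simp only [evenComponent, hak, hal, if_false, hz, hz']
          ring
  by_cases hkl : k = l
  · subst hkl
    by_cases hak : a = k
    · subst hak
      simp only [evenComponent, Ne.symm hab, if_true, if_false, lt_irrefl,
        h.tailProd_self_right hab, diagCoeff_of_ne p q hab]
      rcases lt_or_gt_of_ne hab with hlt | hlt
      · simp only [hlt, not_lt_of_gt hlt, if_true, if_false]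
        rw [mul_comm (p a) (p b)]
        linear_combination (-(A a a * A b a)) * hg a +
          (q - q⁻¹) * diagCoeff p q a a * A a a * hp' b a
      · simp only [hlt, not_lt_of_gt hlt, if_true, if_false]
        linear_combination (-(A a a * A b a)) * hg a
    · by_cases hbk : b = k
      · subst hbk
        simp only [evenComponent, hab, if_true, if_false, lt_irrefl,
          h.tailProd_self_right (Ne.symm hab), diagCoeff_of_ne p q hab,
          diagCoeff_of_ne p q (Ne.symm hab)]
        split_ifs <;> ring
      · have hz := h.col a b k hak hbk hab
        simp only [evenComponent, hak, hbk, if_false, hz]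
        ring
  by_cases hak : a = k
  · subst hak
    by_cases hbl : b = l
    · subst hbl
      simp only [evenComponent, hab, Ne.symm hab, if_false, diagCoeff_of_ne p q hab,
        diagCoeff_of_ne p q (Ne.symm hab)]
      ring
    · have hz := h.chain b a l (Ne.symm hab) hkl hbl
      simp only [evenComponent, hkl, Ne.symm hab, if_false, if_true, diagCoeff_of_ne p q hab,
        diagCoeff_of_ne p q hkl, diagCoeff_of_ne p q (Ne.symm hkl),
        h.tailProd_middle (Ne.symm hab) hkl hbl]
      rcases lt_or_gt_of_ne hab with h1 | h1 <;> rcases lt_or_gt_of_ne hkl with h2 | h2 <;>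
        simp only [h1, h2, not_lt_of_gt h1, not_lt_of_gt h2, if_true, if_false]
      · ring
      · linear_combination (q - q⁻¹) * chi (p a * p b) * diagCoeff p q a a * hz
      · linear_combination (-(q - q⁻¹)) * chi (p a * p b) * diagCoeff p q a a * hz
      · ring
  by_cases hbl : b = l
  · subst hbl
    have hz := h.chain a b k hab (Ne.symm hkl) hak
    simp only [evenComponent, hak, hab, Ne.symm hkl, if_false, diagCoeff_of_ne p q hab,
      diagCoeff_of_ne p q hkl, diagCoeff_of_ne p q (Ne.symm hab), hz]
    ring
  by_cases hal : a = l
  · subst hal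
    by_cases hbk : b = k
    · subst hbk
      have hz : (diagCoeff p q b b - diagCoeff p q a a) * A a b = 0 := by
        by_cases hz : A a b = 0
        · rw [hz]; ring
        · rw [hgc a b hz]; ring
      simp only [evenComponent, hab, if_false, if_true, diagCoeff_of_ne p q hab,
        diagCoeff_of_ne p q (Ne.symm hab)]
      rw [mul_comm (p b)]
      rcases lt_or_gt_of_ne hab with hlt | hlt
      · simp only [hlt, not_lt_of_gt hlt, if_true, if_false]
        linear_combination A b a * hz + (q - q⁻¹) * chi (p a * p b) * h.diag a b hlt
      · simp only [hlt, not_lt_of_gt hlt, if_true, if_false]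
        linear_combination A b a * hz - (q - q⁻¹) * chi (p a * p b) * h.diag b a hlt
    · have hz := h.chain b a k (Ne.symm hab) hak hbk
      have hpz : chi (p k * p a) * A b k = chi (p a * p b) * A b k := by
        by_cases hz : A b k = 0
        · rw [hz]; ring
        · rw [← hA b k hz, mul_comm (p a)]
      simp only [evenComponent, hak, hbk, if_false, if_true, diagCoeff_of_ne p q hab,
        diagCoeff_of_ne p q hkl, diagCoeff_of_ne p q (Ne.symm hbk),
        h.tailProd_middle (Ne.symm hab) hak hbk]
      rcases lt_or_gt_of_ne hab with h1 | h1 <;> rcases lt_or_gt_of_ne hak with h2 | h2 <;>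
        simp only [h1, h2, not_lt_of_gt h1, not_lt_of_gt h2, if_true, if_false]
      · linear_combination (1 - diagCoeff p q a a) * hz - (q - q⁻¹) * A a a * hpz
      · linear_combination (1 - diagCoeff p q a a) * hz
      · linear_combination (1 - diagCoeff p q a a) * hz
      · linear_combination (1 - diagCoeff p q a a) * hz + (q - q⁻¹) * A a a * hpz
  by_cases hbk : b = k
  · subst hbk
    have hz := h.chain a b l hab hkl hal
    simp only [evenComponent, hab, hal, if_false, if_true, diagCoeff_of_ne p q hab,
      diagCoeff_of_ne p q hkl, diagCoeff_of_ne p q (Ne.symm hal),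
      diagCoeff_of_ne p q (Ne.symm hab), h.tailProd_middle hab hkl hal]
    linear_combination (diagCoeff p q b b - 1) * hz
  simp only [evenComponent, hak, hal, hbk, if_false, diagCoeff_of_ne p q hab,
    diagCoeff_of_ne p q hkl, diagCoeff_of_ne p q (Ne.symm hal), diagCoeff_of_ne p q (Ne.symm hak),
    diagCoeff_of_ne p q (Ne.symm hbk)]
  rcases lt_or_gt_of_ne hab with h1 | h1 <;> rcases lt_or_gt_of_ne hkl with h2 | h2 <;>
    simp only [h1, h2, not_lt_of_gt h1, not_lt_of_gt h2, if_true, if_false]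
  · ring
  · linear_combination (q - q⁻¹) * chi (p a * p b) * h.anti a b k l h1 h2 hal hbk
  · linear_combination (-(q - q⁻¹)) * chi (p a * p b) * h.anti b a l k h1 h2 hbk hal
  · ring

end Sufficiency

/-- The reflection equation in terms of the matrix entries. -/
theorem reflectionEquation_iff_entryConditions (hq : q ≠ 0) (hq4 : q ^ 4 ≠ 1)
    (hA : ∀ i j, A i j ≠ 0 → p i = p j) : ReflectionEquation p q A ↔ EntryConditions A := by
  rw [reflectionEquation_iff_of_even hA]
  exact ⟨entryConditions_of_evenComponent hq hq4 hA,
    fun h => h.evenComponent_eq_zero hA hq⟩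

end Even

/-! ### Admissible pairs and their matrices -/

theorem pos_le_pos {i j : Fin N} : pos i ≤ pos j ↔ i ≤ j := by
  simp only [pos, Fin.le_def]; omega

theorem pos_lt_pos {i j : Fin N} : pos i < pos j ↔ i < j := by
  simp only [pos, Fin.lt_def]; omega

theorem pos_injective : Function.Injective (pos : Fin N → ℕ) := by
  intro i j h
  simp only [pos] at h
  ext; omega

theorem pos_le (i : Fin N) : pos i ≤ N := i.2

theorem one_le_pos (i : Fin N) : 1 ≤ pos i := Nat.le_add_left 1 i

theorem exists_pos_eq {n : ℕ} (h1 : 1 ≤ n) (h2 : n ≤ N) : ∃ i : Fin N, pos i = n :=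
  ⟨⟨n - 1, by omega⟩, by simp only [pos]; omega⟩

namespace AdmissiblePair

variable {p : Fin N → ZMod 2} (D : AdmissiblePair p)

theorem min_mem_lower (j : {i // i ∈ D.Y}) : min j.1 (D.σ j) ∈ D.lower := by
  rw [lower, Finset.mem_union, Finset.mem_image, Finset.mem_image]
  rcases lt_or_gt_of_ne (D.no_fixed j) with h | h
  · exact Or.inr ⟨j, by simp [h], (min_eq_right h.le).symm⟩
  · exact Or.inl ⟨j, by simp [h], (min_eq_left h.le).symm⟩

theorem exists_of_mem_lower {c : Fin N} (hc : c ∈ D.lower) : ∃ j, c = min j.1 (D.σ j) := by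
  rw [lower, Finset.mem_union, Finset.mem_image, Finset.mem_image] at hc
  rcases hc with ⟨j, hj, rfl⟩ | ⟨j, hj, rfl⟩
  · exact ⟨j, (min_eq_left (Finset.mem_filter.1 hj).2.le).symm⟩
  · exact ⟨j, (min_eq_right (Finset.mem_filter.1 hj).2.le).symm⟩

theorem max_mem_upper (j : {i // i ∈ D.Y}) : max j.1 (D.σ j) ∈ D.upper := by
  rw [upper, Finset.mem_union, Finset.mem_image, Finset.mem_image]
  rcases lt_or_gt_of_ne (D.no_fixed j) with h | h
  · exact Or.inl ⟨j, by simp [h], (max_eq_left h.le).symm⟩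
  · exact Or.inr ⟨j, by simp [h], (max_eq_right h.le).symm⟩

theorem exists_of_mem_upper {c : Fin N} (hc : c ∈ D.upper) : ∃ j, c = max j.1 (D.σ j) := by
  rw [upper, Finset.mem_union, Finset.mem_image, Finset.mem_image] at hc
  rcases hc with ⟨j, hj, rfl⟩ | ⟨j, hj, rfl⟩
  · exact ⟨j, (max_eq_left (Finset.mem_filter.1 hj).2.le).symm⟩
  · exact ⟨j, (max_eq_right (Finset.mem_filter.1 hj).2.le).symm⟩

theorem bMinus_le_iff {b : ℕ} : D.bMinus ≤ b ↔ ∀ j, pos (min j.1 (D.σ j)) ≤ b := by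
  rw [bMinus]
  split_ifs with h
  · rw [Finset.sup'_le_iff]
    refine ⟨fun h1 j => h1 _ (D.min_mem_lower j), fun h1 c hc => ?_⟩
    obtain ⟨j, rfl⟩ := D.exists_of_mem_lower hc
    exact h1 j
  · exact ⟨fun _ j => absurd ⟨_, D.min_mem_lower j⟩ h, fun _ => Nat.zero_le b⟩

theorem le_bPlus_iff {b : ℕ} :
    b ≤ D.bPlus ↔ b ≤ N + 1 ∧ ∀ j, b ≤ pos (max j.1 (D.σ j)) := by
  rw [bPlus]
  split_ifs with h
  · rw [Finset.le_inf'_iff]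
    refine ⟨fun h1 => ⟨?_, fun j => h1 _ (D.max_mem_upper j)⟩, fun h1 c hc => ?_⟩
    · obtain ⟨c, hc⟩ := h
      exact (h1 c hc).trans ((pos_le c).trans (Nat.le_succ N))
    · obtain ⟨j, rfl⟩ := D.exists_of_mem_upper hc
      exact h1.2 j
  · exact ⟨fun h1 => ⟨h1, fun j => absurd ⟨_, D.max_mem_upper j⟩ h⟩, fun h1 => h1.1⟩

theorem bMinus_lt_bPlus : D.bMinus < D.bPlus := by
  rw [← Nat.succ_le_iff, le_bPlus_iff, Nat.succ_le_succ_iff, bMinus_le_iff]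
  refine ⟨fun j => pos_le _, fun k => ?_⟩
  obtain ⟨n, hn⟩ : ∃ n, pos (max k.1 (D.σ k)) = n + 1 := ⟨_, rfl⟩
  rw [hn, Nat.succ_le_succ_iff, bMinus_le_iff]
  intro j
  rw [← Nat.lt_succ_iff, Nat.succ_eq_add_one, ← hn, pos_lt_pos]
  by_contra! hle
  rw [max_le_iff, le_min_iff, le_min_iff] at hle
  obtain ⟨⟨h1, h2⟩, h3, h4⟩ := hle
  rcases eq_or_lt_of_le h1 with h | h
  · have hkj : k = j := Subtype.ext h
    subst hkj
    exact D.no_fixed k (le_antisymm h3 h2)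
  · exact absurd (D.decreasing (show k < j from h)) (not_lt_of_ge h4)

theorem matrix_apply (x y : Fin N → ℂ) (i j : Fin N) :
    D.matrix x y i j = (if i = j then x i else 0) +
      (if h : j ∈ D.Y then if D.σ ⟨j, h⟩ = i then y j else 0 else 0) := by
  rw [matrix, Matrix.add_apply, Matrix.sum_apply, Matrix.sum_apply]
  congr 1
  · by_cases hij : i = j
    · subst hij
      rw [Finset.sum_eq_single i (by intro k _ hk; simp [e, hk]) (by simp)]
      simp [e]
    · rw [if_neg hij]
      refine Finset.sum_eq_zero fun k _ => ?_
      have : ¬ (k = i ∧ k = j) := fun h => hij (h.1.symm.trans h.2)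
      simp [e, this]
  · split_ifs with h h1
    · rw [Finset.sum_eq_single ⟨j, h⟩]
      · simp [e, h1]
      · intro k _ hk
        have : k.1 ≠ j := fun h2 => hk (Subtype.ext h2)
        simp [e, this]
      · simp
    · refine Finset.sum_eq_zero fun k _ => ?_
      have : ¬ (D.σ k = i ∧ k.1 = j) := by
        rintro ⟨h2, rfl⟩
        exact h1 h2
      simp [e, this]
    · refine Finset.sum_eq_zero fun k _ => ?_
      have : k.1 ≠ j := fun h2 => h (h2 ▸ k.2)
      simp [e, this]

@[simp]
theorem matrix_apply_self (x y : Fin N → ℂ) (i : Fin N) : D.matrix x y i i = x i := by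
  rw [matrix_apply, if_pos rfl]
  split_ifs with h h1
  · exact absurd h1 (D.no_fixed ⟨i, h⟩)
  · simp
  · simp

theorem matrix_apply_σ (x y : Fin N → ℂ) (j : {i // i ∈ D.Y}) :
    D.matrix x y (D.σ j) j.1 = y j.1 := by
  rw [matrix_apply, if_neg (D.no_fixed j), dif_pos j.2, if_pos rfl, zero_add]

theorem exists_of_matrix_apply_ne_zero {x y : Fin N → ℂ} {i j : Fin N} (hij : i ≠ j)
    (h : D.matrix x y i j ≠ 0) : ∃ hj : j ∈ D.Y, D.σ ⟨j, hj⟩ = i := by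
  rw [matrix_apply, if_neg hij, zero_add] at h
  by_cases hj : j ∈ D.Y
  · refine ⟨hj, ?_⟩
    by_contra h1
    rw [dif_pos hj, if_neg h1] at h
    exact h rfl
  · rw [dif_neg hj] at h
    exact absurd rfl h

theorem matrix_even (x y : Fin N → ℂ) (i j : Fin N) (h : D.matrix x y i j ≠ 0) : p i = p j := by
  by_cases hij : i = j
  · rw [hij]
  · obtain ⟨hj, rfl⟩ := D.exists_of_matrix_apply_ne_zero hij h
    exact D.parity ⟨j, hj⟩

/-- A diagonal entry of the truncated square of `∑ x_i e_{ii} + ∑ y_j e_{σ(j) j}`. -/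
theorem tailProd_matrix_self (x y : Fin N → ℂ) (c a : Fin N) :
    tailProd (D.matrix x y) c a a = (if c < a then x a * x a else 0) +
      (if h : a ∈ D.Y then
        if c < D.σ ⟨a, h⟩ then D.matrix x y a (D.σ ⟨a, h⟩) * y a else 0 else 0) := by
  rw [tailProd]
  by_cases h : a ∈ D.Y
  · have hne := D.no_fixed ⟨a, h⟩
    rw [dif_pos h, Finset.sum_eq_add a (D.σ ⟨a, h⟩) hne.symm]
    · rw [matrix_apply_self, D.matrix_apply_σ x y ⟨a, h⟩]
    · rintro m - ⟨h1, h2⟩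
      have : D.matrix x y m a = 0 := by
        by_contra h3
        obtain ⟨_, h4⟩ := D.exists_of_matrix_apply_ne_zero h1 h3
        exact h2 h4.symm
      rw [this, mul_zero, ite_self]
    · simp
    · simp
  · rw [dif_neg h, Finset.sum_eq_single a]
    · rw [matrix_apply_self, add_zero]
    · intro m _ h1
      have : D.matrix x y m a = 0 := by
        by_contra h3
        obtain ⟨h4, _⟩ := D.exists_of_matrix_apply_ne_zero h1 h3
        exact h h4
      rw [this, mul_zero, ite_self]
    · simp

/-- The entry conditions for the matrix of an admissible pair whose only chains `j, σ(j), σ(σ(j))`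
are 2-cycles. -/
theorem entryConditions_matrix {x y : Fin N → ℂ}
    (hinv : ∀ (j : {i // i ∈ D.Y}) (h : D.σ j ∈ D.Y), D.σ ⟨D.σ j, h⟩ = j.1)
    (habove : ∀ (j : {i // i ∈ D.Y}) (c : Fin N), max j.1 (D.σ j) ≤ c → x c = 0)
    (hbelow : ∀ (j : {i // i ∈ D.Y}) (c : Fin N), c < min j.1 (D.σ j) →
      x c = x (min j.1 (D.σ j)))
    (hdiag : ∀ a b, a < b → tailProd (D.matrix x y) b a a - tailProd (D.matrix x y) a b b +
      x a * x b = 0) : EntryConditions (D.matrix x y) where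
  row := by
    intro a k l hak hal hkl
    by_contra hne
    obtain ⟨hk, h1⟩ := D.exists_of_matrix_apply_ne_zero hak (left_ne_zero_of_mul hne)
    obtain ⟨hl, h2⟩ := D.exists_of_matrix_apply_ne_zero hal (right_ne_zero_of_mul hne)
    exact hkl (congrArg Subtype.val (D.decreasing.injective (h1.trans h2.symm)))
  col := by
    intro a b k hak hbk hab
    by_contra hne
    obtain ⟨hk, h1⟩ := D.exists_of_matrix_apply_ne_zero hak (left_ne_zero_of_mul hne)
    obtain ⟨hl, h2⟩ := D.exists_of_matrix_apply_ne_zero hbk (right_ne_zero_of_mul hne)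
    exact hab (h1.symm.trans h2)
  chain := by
    intro i c j hic hcj hij
    by_contra hne
    obtain ⟨hc, rfl⟩ := D.exists_of_matrix_apply_ne_zero hic (left_ne_zero_of_mul hne)
    obtain ⟨hj, rfl⟩ := D.exists_of_matrix_apply_ne_zero hcj (right_ne_zero_of_mul hne)
    exact hij (hinv ⟨j, hj⟩ hc)
  anti := by
    intro a b k l hab hlk hal hbk
    by_contra hne
    obtain ⟨hl, rfl⟩ := D.exists_of_matrix_apply_ne_zero hal (left_ne_zero_of_mul hne)
    obtain ⟨hk, rfl⟩ := D.exists_of_matrix_apply_ne_zero hbk (right_ne_zero_of_mul hne)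
    exact lt_asymm hab (D.decreasing (show (⟨l, hl⟩ : {i // i ∈ D.Y}) < ⟨k, hk⟩ from hlk))
  above := by
    intro i j c hij hne hic hjc
    obtain ⟨hj, rfl⟩ := D.exists_of_matrix_apply_ne_zero hij hne
    rw [matrix_apply_self]
    exact habove ⟨j, hj⟩ c (max_le hjc hic)
  below := by
    intro i j c hij hne hic hjc
    obtain ⟨hj, rfl⟩ := D.exists_of_matrix_apply_ne_zero hij hne
    rw [matrix_apply_self, matrix_apply_self, matrix_apply_self, hbelow ⟨j, hj⟩ c (lt_min hjc hic)]
    have h1 := habove ⟨j, hj⟩ _ le_rfl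
    rcases lt_or_gt_of_ne hij with h | h
    · rw [max_eq_left h.le] at h1
      rw [min_eq_right h.le, h1, add_zero]
    · rw [max_eq_right h.le] at h1
      rw [min_eq_left h.le, h1, zero_add]
  diag := by
    intro a b hab
    rw [matrix_apply_self, matrix_apply_self]
    exact hdiag a b hab

end AdmissiblePair

theorem IsType1.even_and_entryConditions {p : Fin N → ZMod 2} {A : Matrix (Fin N) (Fin N) ℂ}
    (h : IsType1 p A) : (∀ i j, A i j ≠ 0 → p i = p j) ∧ EntryConditions A := by
  obtain ⟨D, x, y, l, m, rfl, -, -, himage, hY, hσ, hx1, hx2, hx3, hy, -⟩ := h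
  have hmem : ∀ j, D.σ j ∈ D.Y := fun j => by
    rw [← himage]; exact Finset.mem_image_of_mem _ (Finset.mem_attach _ j)
  have hlo := fun j => (D.bMinus_le_iff.1 le_rfl) j
  have hhi := fun j => (D.le_bPlus_iff.1 le_rfl).2 j
  have hlt := D.bMinus_lt_bPlus
  refine ⟨D.matrix_even x y, D.entryConditions_matrix ?_ ?_ ?_ ?_⟩
  · intro j h
    apply pos_injective
    have h1 := hσ j
    have h2 := hσ ⟨D.σ j, h⟩
    dsimp only at h2
    omega
  · intro j c hc
    exact hx3 c ((hhi j).trans (pos_le_pos.2 hc))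
  · intro j c hc
    rw [hx1 _ (hlo j), hx1 c ((pos_lt_pos.2 hc).le.trans (hlo j))]
  · intro a b hab
    have hcyc : ∀ (c d : Fin N), (if h : d ∈ D.Y then
        if c < D.σ ⟨d, h⟩ then D.matrix x y d (D.σ ⟨d, h⟩) * y d else 0 else 0) =
        if d ∈ D.Y ∧ pos c + pos d < D.bPlus + D.bMinus then -(l * m) else 0 := by
      intro c d
      by_cases hd : d ∈ D.Y
      · have h1 := hσ ⟨d, hd⟩
        dsimp only at h1
        have h2 : D.matrix x y d (D.σ ⟨d, hd⟩) = y (D.σ ⟨d, hd⟩) := by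
          have h3 := D.matrix_apply_σ x y ⟨D.σ ⟨d, hd⟩, hmem _⟩
          have h4 : D.σ ⟨D.σ ⟨d, hd⟩, hmem _⟩ = d := by
            apply pos_injective
            have h5 := hσ ⟨D.σ ⟨d, hd⟩, hmem _⟩
            dsimp only at h5
            omega
          rwa [h4] at h3
        have h3 : c < D.σ ⟨d, hd⟩ ↔ pos c + pos d < D.bPlus + D.bMinus := by
          rw [← pos_lt_pos]; omega
        simp only [hd, dif_pos, h2, h3, true_and]
        rw [← hy ⟨d, hd⟩, mul_comm]
      · simp [hd]
    rw [D.tailProd_matrix_self, D.tailProd_matrix_self, hcyc, hcyc, if_neg (not_lt_of_gt hab),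
      if_pos hab]
    simp only [hY]
    have hab' := pos_lt_pos.2 hab
    have ha1 := one_le_pos a
    by_cases hb1 : pos b ≤ D.bMinus
    · rw [hx1 b hb1, hx1 a (by omega), if_pos (by omega), if_pos (by omega)]
      ring
    · by_cases hb2 : pos b < D.bPlus
      · rw [hx2 b (by omega) hb2, if_neg (c := _ ∧ pos a + pos b < _) (by omega)]
        by_cases ha : pos a ≤ D.bMinus
        · rw [hx1 a ha, if_pos (by omega)]
          ring
        · rw [hx2 a (by omega) (by omega), if_neg (by omega)]
          ring
      · rw [hx3 b (by omega)]
        by_cases hs : pos a + pos b < D.bPlus + D.bMinus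
        · rw [if_pos (by omega), if_pos (by omega)]
          ring
        · rw [if_neg (by omega), if_neg (by omega)]
          ring

theorem IsType2.even_and_entryConditions {p : Fin N → ZMod 2} {A : Matrix (Fin N) (Fin N) ℂ}
    (h : IsType2 p A) : (∀ i j, A i j ≠ 0 → p i = p j) ∧ EntryConditions A := by
  obtain ⟨D, x, y, b₀, l, rfl, hdisj, hb1, hb2, hx1, hx2, -⟩ := h
  have hnot : ∀ j, D.σ j ∉ D.Y := fun j hj => by
    have : D.σ j ∈ D.Y ∩ D.image :=
      Finset.mem_inter.2 ⟨hj, Finset.mem_image_of_mem _ (Finset.mem_attach _ j)⟩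
    rw [hdisj] at this
    exact absurd this (Finset.notMem_empty _)
  have hlo := fun j => ((D.bMinus_le_iff.1 le_rfl) j).trans hb1
  have hhi := fun j => hb2.trans_le ((D.le_bPlus_iff.1 le_rfl).2 j)
  refine ⟨D.matrix_even x y, D.entryConditions_matrix ?_ ?_ ?_ ?_⟩
  · intro j h
    exact absurd h (hnot j)
  · intro j c hc
    exact hx2 c ((hhi j).trans_le (pos_le_pos.2 hc))
  · intro j c hc
    rw [hx1 _ (hlo j), hx1 c ((pos_lt_pos.2 hc).le.trans (hlo j))]
  · intro a b hab
    have hcyc : ∀ (c d : Fin N), (if h : d ∈ D.Y then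
        if c < D.σ ⟨d, h⟩ then D.matrix x y d (D.σ ⟨d, h⟩) * y d else 0 else 0) = 0 := by
      intro c d
      split_ifs with h1 h2
      · have : D.matrix x y d (D.σ ⟨d, h1⟩) = 0 := by
          by_contra h3
          obtain ⟨h4, _⟩ := D.exists_of_matrix_apply_ne_zero (D.no_fixed ⟨d, h1⟩).symm h3
          exact hnot _ h4
        rw [this, zero_mul]
      · rfl
      · rfl
    rw [D.tailProd_matrix_self, D.tailProd_matrix_self, hcyc, hcyc, if_neg (not_lt_of_gt hab),
      if_pos hab]
    by_cases hb : pos b ≤ b₀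
    · rw [hx1 b hb, hx1 a ((pos_lt_pos.2 hab).le.trans hb)]
      ring
    · rw [hx2 b (not_le.1 hb)]
      ring

/-! ### Solving the entry conditions -/

theorem tailProd_self_of_no_cycle {A : Matrix (Fin N) (Fin N) ℂ} {a : Fin N}
    (hno : ∀ d, a ≠ d → A a d * A d a = 0) (c : Fin N) :
    tailProd A c a a = if c < a then A a a * A a a else 0 := by
  rw [tailProd, Finset.sum_eq_single a]
  · intro m _ hm
    rw [hno m hm.symm, ite_self]
  · simp

namespace EntryConditions

variable {A : Matrix (Fin N) (Fin N) ℂ} (h : EntryConditions A)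

include h

theorem row_unique {i j j' : Fin N} (hij : i ≠ j) (hne : A i j ≠ 0) (hij' : i ≠ j')
    (hne' : A i j' ≠ 0) : j = j' := by
  by_contra hjj
  exact mul_ne_zero hne hne' (h.row i j j' hij hij' hjj)

theorem col_unique {i i' j : Fin N} (hij : i ≠ j) (hne : A i j ≠ 0) (hij' : i' ≠ j)
    (hne' : A i' j ≠ 0) : i = i' := by
  by_contra hii
  exact mul_ne_zero hne hne' (h.col i i' j hij hij' hii)

theorem row_lt_of_col_lt {i j i' j' : Fin N} (hij : i ≠ j) (hne : A i j ≠ 0) (hij' : i' ≠ j')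
    (hne' : A i' j' ≠ 0) (hjj : j < j') : i' < i := by
  by_contra hle
  rcases eq_or_lt_of_le (not_lt.1 hle) with rfl | hlt
  · exact hjj.ne (h.row_unique hij hne hij' hne')
  · exact mul_ne_zero hne hne' (h.anti i i' j' j hlt hjj hij hij')

/-- A diagonal entry of the truncated square at an index that belongs to a 2-cycle. -/
theorem tailProd_self_of_cycle {a d : Fin N} (had : a ≠ d) (hne : A d a ≠ 0) (c : Fin N) :
    tailProd A c a a =
      (if c < a then A a a * A a a else 0) + (if c < d then A a d * A d a else 0) := by
  rw [tailProd, Finset.sum_eq_add a d had]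
  · rintro m - ⟨hma, hmd⟩
    have : A m a = 0 := by
      by_contra h1
      exact hmd (h.col_unique hma h1 had.symm hne)
    rw [this, mul_zero, ite_self]
  · simp
  · simp

/-- The off-diagonal part of a solution is carried by an admissible pair. -/
theorem exists_admissiblePair {p : Fin N → ZMod 2} (hA : ∀ i j, A i j ≠ 0 → p i = p j) :
    ∃ (D : AdmissiblePair p) (y : Fin N → ℂ), A = D.matrix (fun i => A i i) y ∧
      (∀ j : {i // i ∈ D.Y}, y j.1 = A (D.σ j) j.1 ∧ A (D.σ j) j.1 ≠ 0) ∧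
      ∀ i j, i ≠ j → A i j ≠ 0 → ∃ hj : j ∈ D.Y, D.σ ⟨j, hj⟩ = i := by
  classical
  let Y : Finset (Fin N) := Finset.univ.filter fun j => ∃ i, i ≠ j ∧ A i j ≠ 0
  have hY : ∀ j : {i // i ∈ Y}, ∃ i, i ≠ j.1 ∧ A i j.1 ≠ 0 := fun j =>
    (Finset.mem_filter.1 j.2).2
  choose σ hσ hne using hY
  let D : AdmissiblePair p :=
    { Y := Y
      σ := σ
      parity := fun j => hA _ _ (hne j)
      decreasing := fun j k hjk => h.row_lt_of_col_lt (hσ j) (hne j) (hσ k) (hne k) hjk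
      no_fixed := hσ }
  have hD : ∀ i j, i ≠ j → A i j ≠ 0 → ∃ hj : j ∈ D.Y, D.σ ⟨j, hj⟩ = i := by
    intro i j hij hz
    have hj : j ∈ Y := Finset.mem_filter.2 ⟨Finset.mem_univ j, i, hij, hz⟩
    exact ⟨hj, h.col_unique (hσ ⟨j, hj⟩) (hne ⟨j, hj⟩) hij hz⟩
  let y : Fin N → ℂ := fun j => if hj : j ∈ Y then A (σ ⟨j, hj⟩) j else 0
  have hy : ∀ j : {i // i ∈ Y}, y j.1 = A (σ j) j.1 := fun j => dif_pos j.2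
  refine ⟨D, y, ?_, fun j => ⟨hy j, hne j⟩, hD⟩
  ext i j
  by_cases hij : i = j
  · subst hij
    rw [D.matrix_apply_self]
  · by_cases hz : A i j = 0
    · rw [hz, D.matrix_apply, if_neg hij, zero_add]
      split_ifs with hj h1
      · exact absurd hz (h1 ▸ hne ⟨j, hj⟩)
      · rfl
      · rfl
    · obtain ⟨hj, rfl⟩ := hD i j hij hz
      rw [D.matrix_apply_σ]
      exact (hy ⟨j, hj⟩).symm

/-- Without 2-cycles the solution belongs to the second family. -/
theorem isType2 {p : Fin N → ZMod 2} (hA : ∀ i j, A i j ≠ 0 → p i = p j)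
    (hno : ∀ a d, a ≠ d → A a d * A d a = 0) : IsType2 p A := by
  obtain ⟨D, y, hAD, hy, hD⟩ := h.exists_admissiblePair hA
  have hdisj : D.Y ∩ D.image = ∅ := by
    refine Finset.eq_empty_of_forall_notMem fun c hc => ?_
    obtain ⟨hcY, hc⟩ := Finset.mem_inter.1 hc
    obtain ⟨j, -, rfl⟩ := Finset.mem_image.1 hc
    have h1 := (hy ⟨D.σ j, hcY⟩).2
    have h2 := D.no_fixed ⟨D.σ j, hcY⟩
    dsimp only at h1 h2
    by_cases hj : D.σ ⟨D.σ j, hcY⟩ = j.1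
    · rw [hj] at h1
      exact mul_ne_zero h1 (hy j).2 (hno _ _ (D.no_fixed j).symm)
    · exact mul_ne_zero h1 (hy j).2 (h.chain _ _ _ h2 (D.no_fixed j) hj)
  have hdiag : ∀ a b, a < b → A b b * (A a a - A b b) = 0 := by
    intro a b hab
    have h1 := h.diag a b hab
    rw [tailProd_self_of_no_cycle (hno a), tailProd_self_of_no_cycle (hno b),
      if_neg (not_lt_of_gt hab), if_pos hab] at h1
    linear_combination h1
  have hyne : ∀ j ∈ D.Y, y j ≠ 0 := fun j hj => by
    rw [(hy ⟨j, hj⟩).1]; exact (hy ⟨j, hj⟩).2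
  by_cases hzero : ∀ i, A i i = 0
  · exact ⟨D, fun i => A i i, y, D.bMinus, 0, hAD, hdisj, le_rfl, D.bMinus_lt_bPlus,
      fun i _ => hzero i, fun i _ => hzero i, hyne⟩
  · push Not at hzero
    -- `b` is the last position with a nonzero diagonal entry
    obtain ⟨i₀, hi₀, hmax⟩ := Finset.exists_max_image
      (Finset.univ.filter fun i => A i i ≠ 0) id
      (by obtain ⟨i, hi⟩ := hzero; exact ⟨i, by simpa using hi⟩)
    have hi₀ : A i₀ i₀ ≠ 0 := (Finset.mem_filter.1 hi₀).2
    have hmax : ∀ i, i₀ < i → A i i = 0 := fun i hi => by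
      by_contra hne
      exact absurd hi (not_lt_of_ge (hmax i (by simpa using hne)))
    refine ⟨D, fun i => A i i, y, pos i₀, A i₀ i₀, hAD, hdisj, ?_, ?_, ?_, ?_, hyne⟩
    · rw [D.bMinus_le_iff]
      intro j
      rw [pos_le_pos]
      by_contra hlt
      obtain ⟨h1, h2⟩ := lt_min_iff.1 (not_le.1 hlt)
      apply hi₀
      rw [h.below _ _ i₀ (D.no_fixed j) (hy j).2 h2 h1, hmax _ h1, hmax _ h2, add_zero]
    · rw [← Nat.succ_le_iff, D.le_bPlus_iff]
      refine ⟨Nat.succ_le_succ (pos_le i₀), fun j => ?_⟩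
      rw [Nat.succ_le_iff, pos_lt_pos]
      by_contra hle
      obtain ⟨h1, h2⟩ := max_le_iff.1 (not_lt.1 hle)
      exact hi₀ (h.above _ _ i₀ (D.no_fixed j) (hy j).2 h2 h1)
    · intro i hi
      rcases eq_or_lt_of_le (pos_le_pos.1 hi) with rfl | hlt
      · rfl
      · exact sub_eq_zero.1 ((mul_eq_zero.1 (hdiag i i₀ hlt)).resolve_left hi₀)
    · intro i hi
      exact hmax i (pos_lt_pos.1 hi)

end EntryConditions

/-- A 2-cycle `a < d` of the off-diagonal part of `A` such that no 2-cycle starts to the right of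
`a`. -/
structure IsInnermost (A : Matrix (Fin N) (Fin N) ℂ) (a d : Fin N) : Prop where
  lt : a < d
  ne_zero : A a d * A d a ≠ 0
  le_of_cycle : ∀ a' d', a' < d' → A a' d' * A d' a' ≠ 0 → a' ≤ a

theorem exists_isInnermost {A : Matrix (Fin N) (Fin N) ℂ} {a d : Fin N} (had : a ≠ d)
    (hne : A a d * A d a ≠ 0) : ∃ a₀ d₀, IsInnermost A a₀ d₀ := by
  classical
  obtain ⟨a₀, ha₀, hmax⟩ := Finset.exists_max_image
    (Finset.univ.filter fun a => ∃ d, a < d ∧ A a d * A d a ≠ 0) id (by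
      rcases lt_or_gt_of_ne had with hlt | hlt
      · exact ⟨a, Finset.mem_filter.2 ⟨Finset.mem_univ _, d, hlt, hne⟩⟩
      · exact ⟨d, Finset.mem_filter.2 ⟨Finset.mem_univ _, a, hlt, by rwa [mul_comm]⟩⟩)
  obtain ⟨d₀, hlt, h0⟩ := (Finset.mem_filter.1 ha₀).2
  exact ⟨a₀, d₀, hlt, h0, fun a' d' hlt' hne' =>
    hmax a' (Finset.mem_filter.2 ⟨Finset.mem_univ _, d', hlt', hne'⟩)⟩

namespace IsInnermost

variable {A : Matrix (Fin N) (Fin N) ℂ} {a₀ d₀ : Fin N} (h : EntryConditions A)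
  (hin : IsInnermost A a₀ d₀)

include h hin

theorem diag_eq_zero {c : Fin N} (hc : d₀ ≤ c) : A c c = 0 :=
  h.above d₀ a₀ c hin.lt.ne' (right_ne_zero_of_mul hin.ne_zero) hc (hin.lt.le.trans hc)

theorem diag_eq {c : Fin N} (hc : c ≤ a₀) : A c c = A a₀ a₀ := by
  rcases eq_or_lt_of_le hc with rfl | hlt
  · rfl
  · rw [h.below d₀ a₀ c hin.lt.ne' (right_ne_zero_of_mul hin.ne_zero) (hlt.trans hin.lt) hlt,
      hin.diag_eq_zero h le_rfl, zero_add]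

/-- Every index left of the innermost 2-cycle starts a 2-cycle around it, of the same weight. -/
theorem exists_cycle {a : Fin N} (ha : a ≤ a₀) :
    ∃ d, d₀ ≤ d ∧ a ≠ d ∧ A a d * A d a = A a₀ d₀ * A d₀ a₀ := by
  rcases eq_or_lt_of_le ha with rfl | hlt
  · exact ⟨d₀, le_rfl, hin.lt.ne, rfl⟩
  have h0 := right_ne_zero_of_mul hin.ne_zero
  have h1 := h.diag a a₀ hlt
  rw [h.tailProd_self_of_cycle hin.lt.ne h0, if_pos hlt, if_pos (hlt.trans hin.lt),
    hin.diag_eq h ha] at h1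
  have h2 : tailProd A a₀ a a = A a₀ d₀ * A d₀ a₀ := by linear_combination h1
  by_cases hno : ∀ d, a ≠ d → A a d * A d a = 0
  · rw [tailProd_self_of_no_cycle hno, if_neg (not_lt_of_gt hlt)] at h2
    exact absurd h2.symm hin.ne_zero
  · push Not at hno
    obtain ⟨d, had, hne⟩ := hno
    have hda := right_ne_zero_of_mul hne
    rw [h.tailProd_self_of_cycle had hda, if_neg (not_lt_of_gt hlt), zero_add] at h2
    have h3 : a₀ < d := by
      by_contra h3
      rw [if_neg h3] at h2
      exact hin.ne_zero h2.symm
    rw [if_pos h3] at h2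
    exact ⟨d, (h.row_lt_of_col_lt had.symm hda hin.lt.ne' h0 hlt).le, had, h2⟩

/-- The 2-cycles are nested without gaps: stepping to the left from `a₀` moves the other end to the
right by exactly one. -/
theorem pos_add_pos (t : ℕ) : ∀ a d : Fin N, pos a + t = pos a₀ → d ≠ a → A d a ≠ 0 →
    pos d = pos d₀ + t := by
  have h0 := right_ne_zero_of_mul hin.ne_zero
  induction t with
  | zero =>
    intro a d ha hda hne
    have : a = a₀ := pos_injective ha
    subst this
    rw [h.col_unique hda hne hin.lt.ne' h0, add_zero]
  | succ t ih =>
    intro a d ha hda hne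
    have haa : a ≤ a₀ := pos_le_pos.1 (by omega)
    obtain ⟨a', ha'⟩ : ∃ a' : Fin N, pos a' = pos a + 1 :=
      exists_pos_eq (by omega) (by have := pos_le a₀; omega)
    obtain ⟨d', -, hne', hcyc'⟩ := hin.exists_cycle h (a := a') (pos_le_pos.1 (by omega))
    have hda' := right_ne_zero_of_mul (hcyc' ▸ hin.ne_zero)
    have hpos' := ih a' d' (by omega) hne'.symm hda'
    have hdd : d' < d := h.row_lt_of_col_lt hda hne hne'.symm hda' (pos_lt_pos.1 (by omega))
    have hlt' := pos_lt_pos.2 hin.lt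
    have hdd' := pos_lt_pos.2 hdd
    by_contra hcon
    -- otherwise the index `b` right after `d'` would have to end a 2-cycle starting between
    -- `a` and `a' = a + 1`
    obtain ⟨b, hb⟩ : ∃ b : Fin N, pos b = pos d' + 1 :=
      exists_pos_eq (by omega) (by have := pos_le d; omega)
    have hab : a < b := pos_lt_pos.1 (by omega)
    have hbd : b < d := pos_lt_pos.1 (by omega)
    obtain ⟨d₂, -, hne₂, hcyc⟩ := hin.exists_cycle h haa
    obtain rfl : d₂ = d :=
      h.col_unique hne₂.symm (right_ne_zero_of_mul (hcyc ▸ hin.ne_zero)) hda hne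
    have h1 := h.diag a b hab
    rw [hin.diag_eq_zero h (c := b) (pos_le_pos.1 (by omega)), h.tailProd_self_of_cycle hda.symm hne,
      if_neg (not_lt_of_gt hab), if_pos hbd, hcyc] at h1
    by_cases hno : ∀ e, b ≠ e → A b e * A e b = 0
    · rw [tailProd_self_of_no_cycle hno, hin.diag_eq_zero h (c := b) (pos_le_pos.1 (by omega)),
        if_pos hab] at h1
      apply hin.ne_zero
      linear_combination h1
    · push Not at hno
      obtain ⟨e, hbe, hcb⟩ := hno
      have heb := right_ne_zero_of_mul hcb
      rw [h.tailProd_self_of_cycle hbe heb, hin.diag_eq_zero h (c := b) (pos_le_pos.1 (by omega)),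
        if_pos hab] at h1
      have hae : a < e := by
        by_contra hae
        rw [if_neg hae] at h1
        apply hin.ne_zero
        linear_combination h1
      have hea : e < a' := h.row_lt_of_col_lt hne' (left_ne_zero_of_mul
        (hcyc' ▸ hin.ne_zero)) hbe.symm heb (pos_lt_pos.1 (by omega))
      have := pos_lt_pos.2 hae
      have := pos_lt_pos.2 hea
      omega

/-- No 2-cycle meets the indices strictly between `a₀` and `d₀`. -/
theorem no_cycle_of_between {b : Fin N} (hab : a₀ < b) (hbd : b < d₀) (e : Fin N) (hbe : b ≠ e) :
    A b e * A e b = 0 := by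
  by_contra hne
  rcases lt_or_gt_of_ne hbe with hlt | hlt
  · exact absurd hab (not_lt_of_ge (hin.le_of_cycle b e hlt hne))
  · have hea := hin.le_of_cycle e b hlt (by rwa [mul_comm])
    have hea' := pos_le_pos.2 hea
    have h1 := hin.pos_add_pos h (pos a₀ - pos e) e b (by omega) hbe (left_ne_zero_of_mul hne)
    have := pos_lt_pos.2 hbd
    omega

/-- The diagonal entries strictly between `a₀` and `d₀` are roots of one quadratic equation. -/
theorem quadratic {b : Fin N} (hab : a₀ < b) (hbd : b < d₀) :
    A b b * A b b - A a₀ a₀ * A b b - A a₀ d₀ * A d₀ a₀ = 0 := by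
  have h1 := h.diag a₀ b hab
  rw [tailProd_self_of_no_cycle (hin.no_cycle_of_between h hab hbd),
    h.tailProd_self_of_cycle hin.lt.ne (right_ne_zero_of_mul hin.ne_zero),
    if_neg (not_lt_of_gt hab), if_pos hbd, if_pos hab] at h1
  linear_combination -h1

theorem diag_ne_zero {b : Fin N} (hab : a₀ < b) (hbd : b < d₀) : A b b ≠ 0 := by
  intro h0
  have h1 := hin.quadratic h hab hbd
  rw [h0] at h1
  apply hin.ne_zero
  linear_combination -h1

theorem diag_eq_diag {b b' : Fin N} (hab : a₀ < b) (hbb : b < b') (hbd : b' < d₀) :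
    A b b = A b' b' := by
  have h1 := h.diag b b' hbb
  rw [tailProd_self_of_no_cycle (hin.no_cycle_of_between h hab (hbb.trans hbd)),
    tailProd_self_of_no_cycle (hin.no_cycle_of_between h (hab.trans hbb) hbd),
    if_neg (not_lt_of_gt hbb), if_pos hbb] at h1
  refine sub_eq_zero.1 ((mul_eq_zero.1 ?_).resolve_left
    (hin.diag_ne_zero h (hab.trans hbb) hbd))
  linear_combination h1

/-- The diagonal entries strictly between `a₀` and `d₀` share a value, which is a root of the
quadratic equation; if there are none, any root will do. -/
theorem exists_root : ∃ l : ℂ, l * l - A a₀ a₀ * l - A a₀ d₀ * A d₀ a₀ = 0 ∧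
    ∀ b, a₀ < b → b < d₀ → A b b = l := by
  by_cases hgap : ∃ b, a₀ < b ∧ b < d₀
  · obtain ⟨b, hab, hbd⟩ := hgap
    refine ⟨A b b, hin.quadratic h hab hbd, fun b' hab' hbd' => ?_⟩
    rcases lt_trichotomy b b' with hlt | rfl | hlt
    · exact (hin.diag_eq_diag h hab hlt hbd').symm
    · rfl
    · exact hin.diag_eq_diag h hab' hlt hbd
  · obtain ⟨s, hs⟩ := IsAlgClosed.exists_eq_mul_self
      (A a₀ a₀ * A a₀ a₀ + 4 * (A a₀ d₀ * A d₀ a₀))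
    refine ⟨(A a₀ a₀ + s) / 2, ?_, fun b hab hbd => absurd ⟨b, hab, hbd⟩ hgap⟩
    linear_combination (-1 / 4) * hs

/-- Every off-diagonal entry belongs to one of the nested 2-cycles. -/
theorem pos_add_pos_of_ne_zero {i j : Fin N} (hij : i ≠ j) (hne : A i j ≠ 0) :
    pos i + pos j = pos a₀ + pos d₀ ∧ (pos j ≤ pos a₀ ∨ pos i ≤ pos a₀) ∧
      A i j * A j i = A a₀ d₀ * A d₀ a₀ := by
  have hz := hin.ne_zero
  by_cases hj : j ≤ a₀
  · have hj' := pos_le_pos.2 hj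
    have h1 := hin.pos_add_pos h (pos a₀ - pos j) j i (by omega) hij hne
    obtain ⟨d, -, hjd, hcyc⟩ := hin.exists_cycle h hj
    obtain rfl := h.col_unique hjd.symm (right_ne_zero_of_mul (hcyc ▸ hz)) hij hne
    exact ⟨by omega, Or.inl hj', by rw [mul_comm, hcyc]⟩
  by_cases hi : i ≤ a₀
  · have hi' := pos_le_pos.2 hi
    obtain ⟨d, -, hid, hcyc⟩ := hin.exists_cycle h hi
    obtain rfl := h.row_unique hid (left_ne_zero_of_mul (hcyc ▸ hz)) hij hne
    have h1 := hin.pos_add_pos h (pos a₀ - pos i) i d (by omega) hid.symm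
      (right_ne_zero_of_mul (hcyc ▸ hz))
    exact ⟨by omega, Or.inr hi', hcyc⟩
  exfalso
  have hi := not_le.1 hi
  have hj := not_le.1 hj
  have hid : i < d₀ :=
    h.row_lt_of_col_lt hin.lt.ne' (right_ne_zero_of_mul hz) hij hne hj
  have hjd : j < d₀ := by
    by_contra hjd
    rcases eq_or_lt_of_le (not_lt.1 hjd) with rfl | hlt
    · exact hi.ne (h.col_unique hin.lt.ne (left_ne_zero_of_mul hz) hij hne)
    · exact lt_asymm hi (h.row_lt_of_col_lt hin.lt.ne (left_ne_zero_of_mul hz) hij hne hlt)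
  rcases lt_or_gt_of_ne hij with hlt | hlt
  · exact hin.diag_ne_zero h hj hjd (h.above i j j hij hne hlt.le le_rfl)
  · exact hin.diag_ne_zero h hi hid (h.above i j i hij hne le_rfl hlt.le)

/-- A solution with a 2-cycle belongs to the first family. -/
theorem isType1 {p : Fin N → ZMod 2} (hA : ∀ i j, A i j ≠ 0 → p i = p j) : IsType1 p A := by
  obtain ⟨D, y, hAD, hy, hD⟩ := h.exists_admissiblePair hA
  have hz := hin.ne_zero
  have hlt := pos_lt_pos.2 hin.lt
  have ha1 := one_le_pos a₀
  have hfact := fun j => hin.pos_add_pos_of_ne_zero h (D.no_fixed j) (hy j).2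
  have hmemlow : ∀ i, i ≤ a₀ → i ∈ D.Y := fun i hi => by
    obtain ⟨d, -, hid, hcyc⟩ := hin.exists_cycle h hi
    exact (hD d i hid.symm (right_ne_zero_of_mul (hcyc ▸ hz))).1
  have hY : ∀ i, i ∈ D.Y ↔
      pos i ≤ pos a₀ ∨ (pos d₀ ≤ pos i ∧ pos i < pos d₀ + pos a₀) := by
    intro i
    constructor
    · intro hi
      obtain ⟨h1, h2, -⟩ := hfact ⟨i, hi⟩
      dsimp only at h1 h2
      have := one_le_pos (D.σ ⟨i, hi⟩)
      omega
    · rintro (hi | ⟨h1, h2⟩)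
      · exact hmemlow i (pos_le_pos.1 hi)
      · obtain ⟨a, ha⟩ : ∃ a : Fin N, pos a = pos a₀ + pos d₀ - pos i :=
          exists_pos_eq (by omega) (by have := pos_le a₀; omega)
        obtain ⟨d, -, had, hcyc⟩ := hin.exists_cycle h (a := a) (pos_le_pos.1 (by omega))
        have h3 := hin.pos_add_pos h (pos a₀ - pos a) a d (by omega) had.symm
          (right_ne_zero_of_mul (hcyc ▸ hz))
        obtain rfl : d = i := pos_injective (by omega)
        exact (hD a d had (left_ne_zero_of_mul (hcyc ▸ hz))).1
  have hσY : ∀ j, D.σ j ∈ D.Y := fun j => by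
    have h1 := right_ne_zero_of_mul (a := A (D.σ j) j.1) (b := A j.1 (D.σ j))
      ((hfact j).2.2 ▸ hz)
    exact (hD j.1 (D.σ j) (D.no_fixed j).symm h1).1
  have hσσ : ∀ j, D.σ ⟨D.σ j, hσY j⟩ = j.1 := fun j => by
    apply pos_injective
    have h1 := (hfact j).1
    have h2 := (hfact ⟨D.σ j, hσY j⟩).1
    dsimp only at h2
    omega
  have ha₀ := hfact ⟨a₀, hmemlow a₀ le_rfl⟩
  dsimp only at ha₀
  have hσa : D.σ ⟨a₀, hmemlow a₀ le_rfl⟩ = d₀ := pos_injective (by omega)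
  have hbm : D.bMinus = pos a₀ := by
    apply le_antisymm
    · rw [D.bMinus_le_iff]
      intro j
      rcases (hfact j).2.1 with h1 | h1
      · exact (pos_le_pos.2 (min_le_left _ _)).trans h1
      · exact (pos_le_pos.2 (min_le_right _ _)).trans h1
    · have h1 := D.bMinus_le_iff.1 le_rfl ⟨a₀, hmemlow a₀ le_rfl⟩
      rwa [hσa, min_eq_left hin.lt.le] at h1
  have hbp : D.bPlus = pos d₀ := by
    apply le_antisymm
    · have h1 := (D.le_bPlus_iff.1 le_rfl).2 ⟨a₀, hmemlow a₀ le_rfl⟩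
      rwa [hσa, max_eq_right hin.lt.le] at h1
    · rw [D.le_bPlus_iff]
      refine ⟨(pos_le d₀).trans (Nat.le_succ N), fun j => ?_⟩
      have h1 := pos_le_pos.2 (le_max_left j.1 (D.σ j))
      have h2 := pos_le_pos.2 (le_max_right j.1 (D.σ j))
      have h3 := hfact j
      omega
  obtain ⟨l, hl, hgap⟩ := hin.exists_root h
  refine ⟨D, fun i => A i i, y, l, A a₀ a₀ - l, hAD, D.bMinus_lt_bPlus, ?_, ?_, ?_, ?_, ?_, ?_,
    ?_, ?_, ?_⟩
  · -- the partner of the first index sits at position `b₊ + b₋ - 1`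
    obtain ⟨i, hi⟩ : ∃ i : Fin N, pos i = 1 := exists_pos_eq le_rfl (ha1.trans (pos_le a₀))
    have h1 := (hfact ⟨i, hmemlow i (pos_le_pos.1 (by omega))⟩).1
    have h2 := pos_le (D.σ ⟨i, hmemlow i (pos_le_pos.1 (by omega))⟩)
    dsimp only at h1
    omega
  · ext i
    constructor
    · intro hi
      obtain ⟨j, -, rfl⟩ := Finset.mem_image.1 hi
      exact hσY j
    · intro hi
      exact Finset.mem_image.2 ⟨⟨D.σ ⟨i, hi⟩, hσY _⟩, Finset.mem_attach _ _, hσσ ⟨i, hi⟩⟩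
  · rw [hbm, hbp]
    exact hY
  · intro j
    have := (hfact j).1
    omega
  · intro i hi
    change A i i = _
    rw [hin.diag_eq h (pos_le_pos.1 (hi.trans_eq hbm))]
    ring
  · intro i h1 h2
    exact hgap i (pos_lt_pos.1 (hbm ▸ h1)) (pos_lt_pos.1 (hbp ▸ h2))
  · intro i hi
    exact hin.diag_eq_zero h (pos_le_pos.1 (hbp ▸ hi))
  · intro j
    have h1 := (hy ⟨D.σ j, hσY j⟩).1
    rw [hσσ j] at h1
    dsimp only at h1
    rw [(hy j).1, h1, (hfact j).2.2]
    linear_combination -hl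
  · intro h0
    apply hz
    linear_combination -hl - h0

end IsInnermost

theorem isType1_or_isType2_iff (p : Fin N → ZMod 2) (A : Matrix (Fin N) (Fin N) ℂ) :
    IsType1 p A ∨ IsType2 p A ↔ (∀ i j, A i j ≠ 0 → p i = p j) ∧ EntryConditions A := by
  constructor
  · rintro (h | h)
    · exact h.even_and_entryConditions
    · exact h.even_and_entryConditions
  · rintro ⟨hA, h⟩
    by_cases hno : ∀ a d, a ≠ d → A a d * A d a = 0
    · exact Or.inr (h.isType2 hA hno)
    · push Not at hno
      obtain ⟨a, d, had, hne⟩ := hno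
      obtain ⟨a₀, d₀, hin⟩ := exists_isInnermost had hne
      exact Or.inl (hin.isType1 h hA)

end GradedRE
end

/-- The solutions of the graded reflection equation of `GL`-type on `ℂ^N`, for an arbitrary parity
function `p`, are exactly the matrices of the two families; in particular all of them are even. -/
theorem theorem3p1 (N : ℕ) (p : Fin N → ZMod 2) (q : ℂ) (hq : q ≠ 0) (hq4 : q ^ 4 ≠ 1) :
    (∀ A : Matrix (Fin N) (Fin N) ℂ, GradedRE.ReflectionEquation p q A →
      A ∈ GradedRE.grading p 0) ∧
    (∀ A : Matrix (Fin N) (Fin N) ℂ, GradedRE.ReflectionEquation p q A ↔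
      GradedRE.IsType1 p A ∨ GradedRE.IsType2 p A) := by
  have heven : ∀ A : Matrix (Fin N) (Fin N) ℂ, GradedRE.ReflectionEquation p q A →
      ∀ i j, A i j ≠ 0 → p i = p j := fun A hA i j hij => by
    by_contra hp
    exact hij (hA.apply_eq_zero hq hq4 hp)
  refine ⟨fun A hA => (GradedRE.mem_grading_zero_iff p A).2 (heven A hA), fun A => ?_⟩
  rw [GradedRE.isType1_or_isType2_iff]
  exact ⟨fun hA => ⟨heven A hA,
      (GradedRE.reflectionEquation_iff_entryConditions hq hq4 (heven A hA)).1 hA⟩,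
    fun hA => (GradedRE.reflectionEquation_iff_entryConditions hq hq4 hA.1).2 hA.2⟩
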